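/- Let $\mathfrak g$ be a Lie algebra over $\mathbb C$ (of arbitrary dimension), $U\mathfrak g$ its universal enveloping algebra, viewed as a cocommutative bialgebra with unit $\eta$, counit (augmentation) $\varepsilon$ and coproduct $\Delta$ (for which the elements of $\mathfrak g$ are primitive; Sweedler notation $\sum_{(x)}x^{(1)}\otimes\cdots\otimes x^{(n)}$), and let $U\mathfrak g^+=\ker\varepsilon$. Write $\star$ for the convolution product on $\mathrm{End}_{\mathbb C}(U\mathfrak g)$, and $V^\vee$ for the full linear dual of $V$. Let $\mathfrak g$ act on $(U\mathfrak g)^\vee$ and $(U\mathfrak g^+)^\vee$ by $(g\cdot\psi)(x)=\psi(xg)$ and trivially on $\mathbb C$; then $$0\to\mathbb C\to (U\mathfrak g)^\vee\to (U\mathfrak g^+)^\vee\to 0$$ ($c\mapsto c\,\varepsilon$, followed by restriction) is a short exact sequence of $\mathfrak g$-modules. For a $\mathfrak g$-module $V$, let $(C^*(\mathfrak g;V),d_{CE})$, $C^n(\mathfrak g;V)=\mathrm{Hom}(\Lambda^n\mathfrak g,V)$, be the Chevalley–Eilenberg complex, with $$d_{CE}\,\omega(g_0,\dots,g_n)=\sum_j(-1)^j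 g_j\cdot\omega(\dots,\widehat{g_j},\dots)+\sum_{i<j}(-1)^{i+j}\omega([g_i,g_j],\dots,\widehat{g_i},\dots,\widehat{g_j},\dots).$$ Define, for $x\in U\mathfrak g$, $g\in\mathfrak g$ and $t\in\mathbb C$, $$\mathrm{pr}(x)=\sum_{k\ge 0}\frac{(-1)^k}{k+1}(\mathrm{Id}-\eta\varepsilon)^{\star(k+1)}(x),\qquad \phi_t(x)=\sum_{n\ge 0}\frac{t^n}{n!}\,\mathrm{pr}^{\star n}(x),\qquad A_t(x,g)=\sum_{(x)}\phi_{-t}(x^{(1)})\,\phi_t(x^{(2)}g)$$ (the sums are finite for each $x$). The canonical map $\mathfrak g\to U\mathfrak g$ is injective and $\mathrm{pr}(x)$ and $A_t(x,g)$ lie in $\mathfrak g\subset U\mathfrak g$, so that for $f\in C^3(\mathfrak g;\mathbb C)$ the formula $$\tilde\alpha(x,g_1,g_2)=\sum_{(x)}\int_0^1 f\big(\mathrm{pr}(x^{(1)}),A_t(x^{(2)},g_1),A_t(x^{(3)},g_2)\big)\,dt$$ defines a cochain $\tilde\alpha\in C^2(\mathfrak g;(U\mathfrak g)^\vee)$.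 Let $\alpha\in C^2(\mathfrak g;(U\mathfrak g^+)^\vee)$ be its restriction to $U\mathfrak g^+$. If $f$ is a $3$-cocycle, then $$d_{CE}(\tilde\alpha)(x,g_1,g_2,g_3)=\varepsilon(x)\,f(g_1,g_2,g_3)\qquad\text{for all }x\in U\mathfrak g,\ g_1,g_2,g_3\in\mathfrak g;$$ in particular the restriction of $d_{CE}(\tilde\alpha)$ to $\mathbb C\otimes\Lambda^3\mathfrak g\subset U\mathfrak g\otimes\Lambda^3\mathfrak g$ is $f$. Hence $\alpha$ is a $2$-cocycle with values in $(U\mathfrak g^+)^\vee$, and $\partial[\alpha]=[f]$ in $H^3(\mathfrak g;\mathbb C)$, where $\partial:H^2(\mathfrak g;(U\mathfrak g^+)^\vee)\to H^3(\mathfrak g;\mathbb C)$ is the connecting homomorphism of the above short exact sequence. -/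

import Mathlib

noncomputable section

open TensorProduct

set_option linter.unusedSectionVars false

namespace LieCE

variable {L : Type*} [LieRing L] [LieAlgebra ℂ L]
variable {V : Type*} [AddCommGroup V] [Module ℂ V] [LieRingModule L V] [LieModule ℂ L V]

/-- Chevalley-Eilenberg `n`-cochains of `L` with values in `V`. -/
abbrev Cochain (L : Type*) [LieRing L] [LieAlgebra ℂ L] (V : Type*) [AddCommGroup V] [Module ℂ V]
    (n : ℕ) : Type _ := L [⋀^Fin n]→ₗ[ℂ] V

/-- The value of the Chevalley-Eilenberg differential of `ω` on `v = (v₀, …, vₙ)`. In the second sum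
the bracket `⁅v i, v j⁆` stands at the place of `v i` and the argument `v j` is removed; moving the
bracket to the front multiplies the term by `(-1) ^ i`, which gives the usual sign
`(-1) ^ (i + j)`. -/
def dFun {n : ℕ} (ω : Cochain L V n) (v : Fin (n + 1) → L) : V :=
  (∑ j : Fin (n + 1), (-1 : ℤ) ^ (j : ℕ) • ⁅v j, ω (j.removeNth v)⁆) +
    ∑ j : Fin (n + 1), ∑ i ∈ Finset.univ.filter (fun i : Fin (n + 1) => i < j),
      (-1 : ℤ) ^ (j : ℕ) • ω (j.removeNth (Function.update v i ⁅v i, v j⁆))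

/-- The Lie derivative of a cochain. -/
def lieDer {n : ℕ} (x : L) (ω : Cochain L V n) : Cochain L V n :=
  (LieModule.toEnd ℂ L V x).compAlternatingMap ω -
    { toMultilinearMap := ∑ k : Fin n, ω.toMultilinearMap.compLinearMap
        (Function.update (fun _ => LinearMap.id) k (LieAlgebra.ad ℂ L x))
      map_eq_zero_of_eq' := by
        intro v i j hv hij
        have key : ∀ k, (ω.toMultilinearMap.compLinearMap
            (Function.update (fun _ => LinearMap.id) k (LieAlgebra.ad ℂ L x))) v
              = ω (Function.update v k ⁅x, v k⁆) := by
          intro k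
          simp only [MultilinearMap.compLinearMap_apply, AlternatingMap.coe_multilinearMap]
          congr 1
          funext l
          by_cases h : l = k
          · subst h; simp
          · simp [h]
        simp only [MultilinearMap.toFun_eq_coe, sum_apply, key]
        rw [Fintype.sum_eq_add i j hij]
        · have : Function.update v j ⁅x, v j⁆ =
              (Function.update v i ⁅x, v i⁆) ∘ Equiv.swap i j := by
            funext l
            by_cases h1 : l = i
            · subst h1; simp [hij, hv, hij.symm]
            · by_cases h2 : l = j
              · subst h2; simp [hv]
              · simp [Equiv.swap_apply_of_ne_of_ne h1 h2, h1, h2]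
          rw [this, ω.map_swap _ hij]
          simp
        · rintro k ⟨hki, hkj⟩
          exact ω.map_eq_zero_of_eq _ (by simp [hki.symm, hkj.symm, hv]) hij }

theorem lieDer_apply {n : ℕ} (x : L) (ω : Cochain L V n) (v : Fin n → L) :
    lieDer x ω v = ⁅x, ω v⁆ - ∑ k, ω (Function.update v k ⁅x, v k⁆) := by
  have key : ∀ k, (ω.toMultilinearMap.compLinearMap
      (Function.update (fun _ => LinearMap.id) k (LieAlgebra.ad ℂ L x))) v
        = ω (Function.update v k ⁅x, v k⁆) := by
    intro k
    simp only [MultilinearMap.compLinearMap_apply, AlternatingMap.coe_multilinearMap]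
    congr 1
    funext l
    by_cases h : l = k
    · subst h; simp
    · simp [h]
  simp only [lieDer, AlternatingMap.sub_apply, LinearMap.compAlternatingMap_apply,
    LieModule.toEnd_apply_apply, AlternatingMap.coe_mk, sum_apply, key]

theorem dFun_cons {n : ℕ} (ω : Cochain L V (n + 1)) (x : L) (w : Fin (n + 1) → L) :
    dFun ω (Fin.cons x w : Fin (n + 2) → L) = lieDer x ω w - dFun (ω.curryLeft x) w := by
  have h1 : ∀ k : Fin (n + 1), k.succ.removeNth (Fin.cons x w : Fin (n + 2) → L)
      = Matrix.vecCons x (k.removeNth w) := by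
    intro k; funext l
    refine Fin.cases ?_ (fun l => ?_) l <;> simp [Fin.removeNth, Matrix.vecCons]
  have h2 : ∀ (k i : Fin (n + 1)) (y : L),
      k.succ.removeNth (Function.update (Fin.cons x w : Fin (n + 2) → L) i.succ y)
      = Matrix.vecCons x (k.removeNth (Function.update w i y)) := by
    intro k i y
    rw [← Fin.cons_update]
    funext l
    refine Fin.cases ?_ (fun l => ?_) l <;> simp [Fin.removeNth, Matrix.vecCons]
  have h3 : ∀ (k : Fin (n + 1)) (y : L),
      k.succ.removeNth (Function.update (Fin.cons x w : Fin (n + 2) → L) 0 y)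
      = Matrix.vecCons y (k.removeNth w) := by
    intro k y
    rw [Fin.update_cons_zero]
    funext l
    refine Fin.cases ?_ (fun l => ?_) l <;> simp [Fin.removeNth, Matrix.vecCons]
  have h4 : ∀ (k : Fin (n + 1)) (y : L),
      (-1 : ℤ) ^ (k : ℕ) • ω (Matrix.vecCons y (k.removeNth w)) = ω (Function.update w k y) := by
    intro k y
    rw [← Fin.insertNth_removeNth, AlternatingMap.map_insertNth]
  have h5 : ∀ (k : Fin (n + 1)) (F : Fin (n + 2) → V),
      ∑ i ∈ Finset.univ.filter (fun i : Fin (n + 2) => i < k.succ), F i =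
        F 0 + ∑ i ∈ Finset.univ.filter (fun i : Fin (n + 1) => i < k), F i.succ := by
    intro k F
    rw [Finset.sum_filter, Fin.sum_univ_succ, Finset.sum_filter]
    simp
  rw [lieDer_apply, dFun, Fin.sum_univ_succ, Fin.sum_univ_succ (fun j => ∑ i ∈ _, _)]
  simp only [h5, h1, h2, h3, Fin.cons_succ, Fin.cons_zero, Fin.val_succ, pow_succ, mul_neg, mul_one,
    neg_smul, Finset.sum_add_distrib, Finset.sum_neg_distrib, h4, Fin.val_zero, pow_zero, one_smul,
    dFun, AlternatingMap.curryLeft_apply_apply]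
  simp only [Fin.not_lt_zero, Finset.filter_false, Finset.sum_empty]
  have : (0 : Fin (n + 2)).removeNth (Fin.cons x w : Fin (n + 2) → L) = w := by
    funext l; simp [Fin.removeNth]
  rw [this]
  abel

theorem dFun_zero_deg (ω : Cochain L V 0) (v : Fin 1 → L) : dFun ω v = ⁅v 0, ω ![]⁆ := by
  have h : ∀ w : Fin 0 → L, w = ![] := fun w => by funext k; exact k.elim0
  rw [dFun, Fin.sum_univ_succ, Fin.sum_univ_succ (fun j => ∑ i ∈ _, _)]
  simp [h]

theorem lieDer_add_left {n : ℕ} (x y : L) (ω : Cochain L V n) :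
    lieDer (x + y) ω = lieDer x ω + lieDer y ω := by
  ext v
  simp only [lieDer_apply, AlternatingMap.add_apply, add_lie, AlternatingMap.map_update_add,
    Finset.sum_add_distrib]
  abel

theorem lieDer_smul_left {n : ℕ} (c : ℂ) (x : L) (ω : Cochain L V n) :
    lieDer (c • x) ω = c • lieDer x ω := by
  ext v
  simp only [lieDer_apply, AlternatingMap.smul_apply, smul_lie, AlternatingMap.map_update_smul,
    ← Finset.smul_sum, smul_sub]

theorem lieDer_sub {n : ℕ} (x : L) (ω η : Cochain L V n) :
    lieDer x (ω - η) = lieDer x ω - lieDer x η := by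
  ext v
  simp only [lieDer_apply, AlternatingMap.sub_apply, lie_sub, Finset.sum_sub_distrib]
  abel

theorem dFun_add {n : ℕ} (ω η : Cochain L V n) (v : Fin (n + 1) → L) :
    dFun (ω + η) v = dFun ω v + dFun η v := by
  simp only [dFun, AlternatingMap.add_apply, lie_add, smul_add, Finset.sum_add_distrib]
  abel

theorem dFun_smul {n : ℕ} (c : ℂ) (ω : Cochain L V n) (v : Fin (n + 1) → L) :
    dFun (c • ω) v = c • dFun ω v := by
  simp only [dFun, AlternatingMap.smul_apply, lie_smul, smul_comm _ c, ← Finset.smul_sum,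
    ← smul_add]

/-- Contracting a Lie derivative: `[L_x, ι_y] = ι_{[x,y]}`. -/
theorem curryLeft_lieDer {n : ℕ} (x y : L) (ω : Cochain L V (n + 1)) :
    (lieDer x ω).curryLeft y = lieDer x (ω.curryLeft y) - ω.curryLeft ⁅x, y⁆ := by
  ext v
  simp only [lieDer_apply, AlternatingMap.sub_apply, AlternatingMap.curryLeft_apply_apply,
    Matrix.vecCons, Fin.sum_univ_succ, Fin.update_cons_zero, Fin.cons_zero, Fin.cons_succ,
    Fin.cons_update]
  abel

theorem curryLeft_inj {n : ℕ} {ω η : Cochain L V (n + 1)}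
    (h : ∀ x, ω.curryLeft x = η.curryLeft x) : ω = η := by
  ext v
  have := congrArg (fun a : Cochain L V n => a (Fin.tail v)) (h (v 0))
  simpa [Matrix.vecCons] using this

theorem exists_alternating_dFun (n : ℕ) (ω : Cochain L V n) :
    ∃ η : Cochain L V (n + 1), ∀ v, η v = dFun ω v := by
  induction n with
  | zero =>
    refine ⟨AlternatingMap.ofSubsingleton (ι := Fin 1) ℂ L V 0
      { toFun := fun x => ⁅x, ω ![]⁆, map_add' := by simp, map_smul' := by simp }, fun v => ?_⟩
    rw [dFun_zero_deg]
    rfl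
  | succ n ih =>
    choose D hD using ih
    let F : L →ₗ[ℂ] MultilinearMap ℂ (fun _ : Fin (n + 1) => L) V :=
      { toFun := fun x => (lieDer x ω - D (ω.curryLeft x)).toMultilinearMap
        map_add' := by
          intro x y; ext v
          simp only [AlternatingMap.coe_multilinearMap, AlternatingMap.sub_apply, hD, map_add,
            lieDer_add_left, AlternatingMap.add_apply, _root_.add_apply, dFun_add]
          abel
        map_smul' := by
          intro c x; ext v
          simp only [AlternatingMap.coe_multilinearMap, AlternatingMap.sub_apply, hD, map_smul,
            lieDer_smul_left, AlternatingMap.smul_apply, _root_.smul_apply, dFun_smul,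
            smul_sub, RingHom.id_apply] }
    have hF : ∀ x w, F x w = (lieDer x ω - D (ω.curryLeft x)) w := fun _ _ => rfl
    have hcons : ∀ (x : L) (w : Fin n → L), F x (Matrix.vecCons x w) = 0 := by
      intro x w
      have e1 := congrArg (fun a : Cochain L V n => a w) (curryLeft_lieDer x x ω)
      simp only [AlternatingMap.curryLeft_apply_apply, lie_self, map_zero, sub_zero] at e1
      rw [hF, AlternatingMap.sub_apply, hD, e1]
      cases n with
      | zero =>
        rw [dFun_zero_deg]
        have hw : w = ![] := by funext k; exact k.elim0
        subst hw
        simp [lieDer_apply]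
      | succ m =>
        rw [show (Matrix.vecCons x w : Fin (m + 2) → L) = Fin.cons x w from rfl, dFun_cons,
          AlternatingMap.curryLeft_same]
        simp [dFun]
    have hz : ∀ (v : Fin (n + 2) → L) (j : Fin (n + 2)), j ≠ 0 → v 0 = v j →
        F (v 0) (Fin.tail v) = 0 := by
      intro v j hj hv
      obtain ⟨k, rfl⟩ := Fin.exists_succ_eq.mpr hj
      have : Fin.tail v = k.insertNth (v 0) (k.removeNth (Fin.tail v)) := by
        rw [Fin.insertNth_removeNth, hv]
        simp [Fin.tail]
      rw [hF, this, AlternatingMap.map_insertNth, ← hF, hcons, smul_zero]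
    refine ⟨{ toMultilinearMap := F.uncurryLeft, map_eq_zero_of_eq' := ?_ }, fun v => ?_⟩
    · intro v i j hv hij
      simp only [MultilinearMap.toFun_eq_coe, LinearMap.uncurryLeft_apply]
      by_cases hi : i = 0
      · subst hi; exact hz v j hij.symm hv
      by_cases hj : j = 0
      · subst hj; exact hz v i hi hv.symm
      obtain ⟨i, rfl⟩ := Fin.exists_succ_eq.mpr hi
      obtain ⟨j, rfl⟩ := Fin.exists_succ_eq.mpr hj
      rw [hF]
      exact AlternatingMap.map_eq_zero_of_eq _ _ hv (fun h => hij (by rw [h]))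
    · conv_rhs => rw [← Fin.cons_self_tail v, dFun_cons]
      change F (v 0) (Fin.tail v) = _
      rw [hF, AlternatingMap.sub_apply, hD]

/-- The Chevalley-Eilenberg differential
`(dω)(v₀, …, vₙ) = ∑ⱼ (-1)ʲ vⱼ · ω(…, v̂ⱼ, …) + ∑_{i < j} (-1)ⁱ⁺ʲ ω([vᵢ, vⱼ], …, v̂ᵢ, …, v̂ⱼ, …)`. -/
def d (n : ℕ) : Cochain L V n →ₗ[ℂ] Cochain L V (n + 1) where
  toFun ω :=
    { toFun := dFun ω
      map_update_add' := by
        intro inst v i x y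
        obtain ⟨η, hη⟩ := exists_alternating_dFun n ω
        simp only [← hη]
        exact η.map_update_add' v i x y
      map_update_smul' := by
        intro inst v i c x
        obtain ⟨η, hη⟩ := exists_alternating_dFun n ω
        simp only [← hη]
        exact η.map_update_smul' v i c x
      map_eq_zero_of_eq' := by
        intro v i j hv hij
        obtain ⟨η, hη⟩ := exists_alternating_dFun n ω
        simp only [← hη]
        exact η.map_eq_zero_of_eq v hv hij }
  map_add' ω η := by ext v; exact dFun_add ω η v
  map_smul' c ω := by ext v; exact dFun_smul c ω v

theorem d_apply {n : ℕ} (ω : Cochain L V n) (v : Fin (n + 1) → L) : d n ω v = dFun ω v := rfl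

/-- Cartan's formula `ι_x d + d ι_x = L_x`. -/
theorem curryLeft_d {n : ℕ} (ω : Cochain L V (n + 1)) (x : L) :
    (d (n + 1) ω).curryLeft x = lieDer x ω - d n (ω.curryLeft x) := by
  ext w
  exact dFun_cons ω x w

theorem curryLeft_d_zero (ω : Cochain L V 0) (x : L) : (d 0 ω).curryLeft x = lieDer x ω := by
  ext w
  rw [AlternatingMap.curryLeft_apply_apply, d_apply, dFun_zero_deg, lieDer_apply,
    Subsingleton.elim w ![]]
  simp

theorem lieDer_lie {n : ℕ} (x y : L) (ω : Cochain L V n) :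
    lieDer ⁅x, y⁆ ω = lieDer x (lieDer y ω) - lieDer y (lieDer x ω) := by
  induction n with
  | zero => ext v; simp [lieDer_apply]
  | succ n ih =>
    refine curryLeft_inj fun z => ?_
    change _ = (lieDer x (lieDer y ω)).curryLeft z - (lieDer y (lieDer x ω)).curryLeft z
    simp only [curryLeft_lieDer, ih, lieDer_sub, lie_lie, map_sub]
    abel

theorem lieDer_d {n : ℕ} (x : L) (ω : Cochain L V n) :
    lieDer x (d n ω) = d n (lieDer x ω) := by
  induction n with
  | zero =>
    refine curryLeft_inj fun z => ?_
    simp only [curryLeft_lieDer, curryLeft_d_zero, lieDer_lie]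
    abel
  | succ n ih =>
    refine curryLeft_inj fun z => ?_
    simp only [curryLeft_lieDer, curryLeft_d, lieDer_lie, lieDer_sub, map_sub, ih]
    abel

theorem d_d {n : ℕ} (ω : Cochain L V n) : d (n + 1) (d n ω) = 0 := by
  induction n with
  | zero =>
    refine curryLeft_inj fun z => ?_
    rw [curryLeft_d, curryLeft_d_zero, lieDer_d, sub_self]
    simp
  | succ n ih =>
    refine curryLeft_inj fun z => ?_
    rw [curryLeft_d, curryLeft_d, map_sub, ih, lieDer_d]
    simp

variable (L V) in
/-- Cocycles. -/
def cocycles (n : ℕ) : Submodule ℂ (Cochain L V n) := LinearMap.ker (d n)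

variable (L V) in
/-- Coboundaries. -/
def coboundaries : (n : ℕ) → Submodule ℂ (Cochain L V n)
  | 0 => ⊥
  | n + 1 => LinearMap.range (d n)

variable (L V) in
/-- Lie algebra cohomology `Hⁿ(L; V)`, cocycles modulo coboundaries. -/
abbrev Cohomology (n : ℕ) : Type _ :=
  cocycles L V n ⧸ (coboundaries L V n).submoduleOf (cocycles L V n)

/-- The class of a cocycle. -/
def cls {n : ℕ} (ω : Cochain L V n) (hω : d n ω = 0) : Cohomology L V n :=
  Submodule.Quotient.mk ⟨ω, LinearMap.mem_ker.mpr hω⟩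

section Connecting

variable {V₁ V₂ V₃ : Type*}
  [AddCommGroup V₁] [Module ℂ V₁] [LieRingModule L V₁] [LieModule ℂ L V₁]
  [AddCommGroup V₂] [Module ℂ V₂] [LieRingModule L V₂] [LieModule ℂ L V₂]
  [AddCommGroup V₃] [Module ℂ V₃] [LieRingModule L V₃] [LieModule ℂ L V₃]

/-- The map on cochains induced by a morphism of coefficients. -/
def push (p : V₁ →ₗ⁅ℂ,L⁆ V₂) {n : ℕ} : Cochain L V₁ n →ₗ[ℂ] Cochain L V₂ n where
  toFun ω := (p : V₁ →ₗ[ℂ] V₂).compAlternatingMap ω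
  map_add' ω η := by ext v; simp
  map_smul' c ω := by ext v; simp

theorem push_apply (p : V₁ →ₗ⁅ℂ,L⁆ V₂) {n : ℕ} (ω : Cochain L V₁ n) (v : Fin n → L) :
    push p ω v = p (ω v) := rfl

theorem d_push (p : V₁ →ₗ⁅ℂ,L⁆ V₂) {n : ℕ} (ω : Cochain L V₁ n) :
    d n (push p ω) = push p (d n ω) := by
  ext v
  simp [d_apply, dFun, push_apply]

variable (i : V₁ →ₗ⁅ℂ,L⁆ V₂) (p : V₂ →ₗ⁅ℂ,L⁆ V₃)

theorem push_injective (hi : Function.Injective i) {n : ℕ} {ω η : Cochain L V₁ n}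
    (h : push i ω = push i η) : ω = η := by
  ext v
  exact hi (congrArg (fun a : Cochain L V₂ n => a v) h)

theorem exists_push_of_push_eq_zero (hi : Function.Injective i) (hip : Function.Exact i p) {n : ℕ}
    (β : Cochain L V₂ n) (h : push p β = 0) : ∃ γ : Cochain L V₁ n, push i γ = β := by
  have hk : LinearMap.ker (i : V₁ →ₗ[ℂ] V₂) = ⊥ := LinearMap.ker_eq_bot.mpr hi
  refine ⟨(i : V₁ →ₗ[ℂ] V₂).leftInverse.compAlternatingMap β, ?_⟩
  ext v
  obtain ⟨y, hy⟩ := (hip (β v)).mp (congrArg (fun a : Cochain L V₃ n => a v) h)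
  have := LinearMap.leftInverse_apply_of_inj hk y
  rw [push_apply, LinearMap.compAlternatingMap_apply, ← hy]
  exact congrArg i this

theorem exists_lift (hp : Function.Surjective p) {n : ℕ} (α : Cochain L V₃ n) :
    ∃ β : Cochain L V₂ n, push p β = α := by
  obtain ⟨s, hs⟩ := (p : V₂ →ₗ[ℂ] V₃).exists_rightInverse_of_surjective
    (LinearMap.range_eq_top.mpr hp)
  refine ⟨s.compAlternatingMap α, ?_⟩
  ext v
  exact congrArg (fun a : V₃ →ₗ[ℂ] V₃ => a (α v)) hs

theorem exists_snake (hi : Function.Injective i) (hip : Function.Exact i p)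
    (hp : Function.Surjective p) {n : ℕ} (α : cocycles L V₃ n) :
    ∃ (β : Cochain L V₂ n) (γ : Cochain L V₁ (n + 1)), push p β = α ∧ d n β = push i γ ∧
      d (n + 1) γ = 0 := by
  obtain ⟨β, hβ⟩ := exists_lift p hp α.1
  obtain ⟨γ, hγ⟩ := exists_push_of_push_eq_zero i p hi hip (d n β) (by
    rw [← d_push, hβ]; exact α.2)
  refine ⟨β, γ, hβ, hγ.symm, push_injective i hi ?_⟩
  rw [← d_push, hγ, d_d, map_zero]

theorem snake_unique (hi : Function.Injective i) (hip : Function.Exact i p)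
    (hp : Function.Surjective p) {n : ℕ} {β β' : Cochain L V₂ n} {γ γ' : Cochain L V₁ (n + 1)}
    (hγ : d n β = push i γ) (hγ' : d n β' = push i γ')
    (h : push p β - push p β' ∈ coboundaries L V₃ n) :
    γ - γ' ∈ coboundaries L V₁ (n + 1) := by
  have main : ∃ μ : Cochain L V₂ n, push p β - push p β' = push p μ ∧ d n μ = 0 := by
    cases n with
    | zero => exact ⟨0, by rw [(Submodule.mem_bot ℂ).mp h, map_zero], map_zero _⟩
    | succ n =>
      obtain ⟨η, hη⟩ := h
      obtain ⟨ξ, hξ⟩ := exists_lift p hp η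
      exact ⟨d n ξ, by rw [← hη, ← d_push, hξ], d_d ξ⟩
  obtain ⟨μ, hμ, hdμ⟩ := main
  obtain ⟨ν, hν⟩ := exists_push_of_push_eq_zero i p hi hip (β - β' - μ) (by
    rw [map_sub, map_sub, hμ, sub_self])
  refine ⟨ν, push_injective i hi ?_⟩
  rw [← d_push, hν, map_sub, map_sub, hγ, hγ', hdμ, map_sub, sub_zero]

/-- A cochain with values in `V₂` lifting the cocycle `α`. -/
def snakeLift (hi : Function.Injective i) (hip : Function.Exact i p)
    (hp : Function.Surjective p) {n : ℕ} (α : cocycles L V₃ n) : Cochain L V₂ n :=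
  (exists_snake i p hi hip hp α).choose

/-- The cocycle `γ` with values in `V₁` such that `i γ = d β` for the chosen lift `β` of `α`. -/
def snakeCocycle (hi : Function.Injective i) (hip : Function.Exact i p)
    (hp : Function.Surjective p) {n : ℕ} (α : cocycles L V₃ n) : Cochain L V₁ (n + 1) :=
  (exists_snake i p hi hip hp α).choose_spec.choose

theorem snake_spec (hi : Function.Injective i) (hip : Function.Exact i p)
    (hp : Function.Surjective p) {n : ℕ} (α : cocycles L V₃ n) :
    push p (snakeLift i p hi hip hp α) = α ∧
      d n (snakeLift i p hi hip hp α) = push i (snakeCocycle i p hi hip hp α) ∧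
      d (n + 1) (snakeCocycle i p hi hip hp α) = 0 :=
  (exists_snake i p hi hip hp α).choose_spec.choose_spec

/-- The connecting homomorphism `Hⁿ(L; V₃) → Hⁿ⁺¹(L; V₁)` of a short exact sequence
`0 → V₁ → V₂ → V₃ → 0` of `L`-modules: the class of a cocycle `α` is sent to the class of `γ`, where
`i γ = d β` for a cochain `β` lifting `α`. -/
def connecting (hi : Function.Injective i) (hip : Function.Exact i p)
    (hp : Function.Surjective p) (n : ℕ) : Cohomology L V₃ n →ₗ[ℂ] Cohomology L V₁ (n + 1) :=
  Submodule.liftQ _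
    { toFun := fun α => cls (snakeCocycle i p hi hip hp α) (snake_spec i p hi hip hp α).2.2
      map_add' := by
        intro α α'
        have h1 := snake_spec i p hi hip hp α
        have h2 := snake_spec i p hi hip hp α'
        have h3 := snake_spec i p hi hip hp (α + α')
        refine (Submodule.Quotient.eq _).mpr (snake_unique i p hi hip hp h3.2.1
          (β' := snakeLift i p hi hip hp α + snakeLift i p hi hip hp α')
          (γ' := snakeCocycle i p hi hip hp α + snakeCocycle i p hi hip hp α') ?_ ?_)
        · rw [map_add, h1.2.1, h2.2.1, map_add]
        · rw [h3.1, map_add, h1.1, h2.1, Submodule.coe_add, sub_self]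
          exact Submodule.zero_mem _
      map_smul' := by
        intro c α
        have h1 := snake_spec i p hi hip hp α
        have h3 := snake_spec i p hi hip hp (c • α)
        refine (Submodule.Quotient.eq _).mpr (snake_unique i p hi hip hp h3.2.1
          (β' := c • snakeLift i p hi hip hp α) (γ' := c • snakeCocycle i p hi hip hp α) ?_ ?_)
        · rw [map_smul, h1.2.1, map_smul]
        · rw [h3.1, map_smul, h1.1, Submodule.coe_smul, sub_self]
          exact Submodule.zero_mem _ }
    (by
      intro α hα
      have h1 := snake_spec i p hi hip hp α
      refine (Submodule.Quotient.mk_eq_zero _).mpr ?_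
      have := snake_unique i p hi hip hp h1.2.1 (β' := 0) (γ' := 0) (by simp) (by
        rw [h1.1, map_zero, sub_zero]
        exact hα)
      rw [sub_zero] at this
      exact this)

theorem connecting_cls (hi : Function.Injective i) (hip : Function.Exact i p)
    (hp : Function.Surjective p) {n : ℕ} (β : Cochain L V₂ n) (γ : Cochain L V₁ (n + 1))
    (h : d n β = push i γ) (hα : d n (push p β) = 0) (hγ : d (n + 1) γ = 0) :
    connecting i p hi hip hp n (cls (push p β) hα) = cls γ hγ := by
  have h1 := snake_spec i p hi hip hp ⟨push p β, LinearMap.mem_ker.mpr hα⟩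
  refine (Submodule.Quotient.eq _).mpr (snake_unique i p hi hip hp h1.2.1 h ?_)
  rw [h1.1, sub_self]
  exact Submodule.zero_mem _

end Connecting

end LieCE

open Coalgebra

namespace EnvelopingLift

open LieCE

attribute [local instance 100] LieRing.ofAssociativeRing

/-- The universal enveloping algebra of a complex Lie algebra. -/
abbrev U (L : Type*) [LieRing L] [LieAlgebra ℂ L] : Type _ := UniversalEnvelopingAlgebra ℂ L

variable {L : Type*} [LieRing L] [LieAlgebra ℂ L]

/-- The canonical map `L → U L` as a linear map. -/
def incl (L : Type*) [LieRing L] [LieAlgebra ℂ L] : L →ₗ[ℂ] U L :=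
  (UniversalEnvelopingAlgebra.ι ℂ : L →ₗ⁅ℂ⁆ U L)

theorem incl_lie (x y : L) : incl L ⁅x, y⁆ = incl L x * incl L y - incl L y * incl L x := by
  have := LieHom.map_lie (UniversalEnvelopingAlgebra.ι ℂ : L →ₗ⁅ℂ⁆ U L) x y
  rw [LieRing.of_associative_ring_bracket] at this
  exact this

variable (L) in
/-- The augmentation `ε : U L → ℂ`, zero on `L`. -/
def augmentation : U L →ₐ[ℂ] ℂ := UniversalEnvelopingAlgebra.lift ℂ (0 : L →ₗ⁅ℂ⁆ ℂ)

variable (L) in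
/-- The coproduct `Δ : U L → U L ⊗ U L`, the algebra map with `Δ x = x ⊗ 1 + 1 ⊗ x` on `L`. -/
def coproduct : U L →ₐ[ℂ] U L ⊗[ℂ] U L :=
  UniversalEnvelopingAlgebra.lift ℂ
    { toFun := fun x => incl L x ⊗ₜ[ℂ] 1 + 1 ⊗ₜ[ℂ] incl L x
      map_add' := by intro x y; simp only [map_add, add_tmul, tmul_add]; abel
      map_smul' := by intro c x; simp [smul_tmul', tmul_smul]
      map_lie' := by
        intro x y
        rw [LieRing.of_associative_ring_bracket]
        simp only [incl_lie, sub_tmul, tmul_sub, mul_add, add_mul,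
          Algebra.TensorProduct.tmul_mul_tmul, mul_one, one_mul]
        abel }

theorem augmentation_incl (x : L) : augmentation L (incl L x) = 0 :=
  UniversalEnvelopingAlgebra.lift_ι_apply ℂ (0 : L →ₗ⁅ℂ⁆ ℂ) x

theorem coproduct_incl (x : L) :
    coproduct L (incl L x) = incl L x ⊗ₜ[ℂ] 1 + 1 ⊗ₜ[ℂ] incl L x :=
  UniversalEnvelopingAlgebra.lift_ι_apply ℂ _ x

theorem algHom_ext {A : Type*} [Ring A] [Algebra ℂ A] {f g : U L →ₐ[ℂ] A}
    (h : ∀ x, f (incl L x) = g (incl L x)) : f = g :=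
  UniversalEnvelopingAlgebra.hom_ext ℂ (LieHom.ext h)

/-- The bialgebra structure of the universal enveloping algebra. -/
instance : Bialgebra ℂ (U L) :=
  Bialgebra.ofAlgHom (coproduct L) (augmentation L)
    (algHom_ext fun x => by
      simp [coproduct_incl, add_tmul, tmul_add, Algebra.TensorProduct.one_def, add_assoc])
    (algHom_ext fun x => by simp [coproduct_incl, augmentation_incl])
    (algHom_ext fun x => by simp [coproduct_incl, augmentation_incl])

theorem counit_eq (x : U L) : counit (R := ℂ) x = augmentation L x := rfl

theorem comul_eq (x : U L) : comul (R := ℂ) x = coproduct L x := rfl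

instance : Coalgebra.IsCocomm ℂ (U L) where
  comm_comp_comul := by
    have h : ((Algebra.TensorProduct.comm ℂ (U L) (U L)).toAlgHom.comp (coproduct L)) =
        coproduct L := algHom_ext fun x => by simp [coproduct_incl, add_comm]
    ext x
    exact congrArg (fun a : U L →ₐ[ℂ] U L ⊗[ℂ] U L => a x) h

/-- The product in `U L` of a word in `L`. -/
def word (l : List L) : U L := (l.map (incl L)).prod

theorem span_word : Submodule.span ℂ (Set.range (word : List L → U L)) = ⊤ := by
  have h1 : Algebra.adjoin ℂ (Set.range (incl L)) = ⊤ := by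
    let S := Algebra.adjoin ℂ (Set.range (incl L))
    let f : L →ₗ⁅ℂ⁆ S :=
      { toFun := fun x => ⟨incl L x, Algebra.subset_adjoin ⟨x, rfl⟩⟩
        map_add' := by intro x y; ext; simp
        map_smul' := by intro c x; ext; simp
        map_lie' := by
          intro x y; ext
          rw [LieRing.of_associative_ring_bracket]
          simp [incl_lie] }
    have h : S.val.comp (UniversalEnvelopingAlgebra.lift ℂ f) = AlgHom.id ℂ (U L) :=
      algHom_ext fun x =>
        congrArg Subtype.val (UniversalEnvelopingAlgebra.lift_ι_apply ℂ f x)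
    refine top_unique fun x _ => ?_
    have hx := congrArg (fun a : U L →ₐ[ℂ] U L => a x) h
    have : ((UniversalEnvelopingAlgebra.lift ℂ f x : S) : U L) = x := hx
    rw [← this]
    exact (UniversalEnvelopingAlgebra.lift ℂ f x).2
  rw [eq_top_iff, ← Algebra.top_toSubmodule, ← h1, Algebra.adjoin_eq_span, Submodule.span_le]
  intro x hx
  obtain ⟨l, hl, rfl⟩ := Submonoid.exists_list_of_mem_closure hx
  choose! g hg using hl
  refine Submodule.subset_span ⟨l.map g, ?_⟩
  rw [word, List.map_map]
  congr 1
  conv_rhs => rw [← List.map_id l]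
  exact List.map_congr_left fun y hy => hg y hy

theorem comul_word (l : List L) : comul (R := ℂ) (word l) ∈ Submodule.span ℂ
    {z : U L ⊗[ℂ] U L | ∃ l₁ l₂ : List L, l₁.length + l₂.length = l.length ∧
      z = word l₁ ⊗ₜ[ℂ] word l₂} := by
  induction l with
  | nil =>
    refine Submodule.subset_span ⟨[], [], rfl, ?_⟩
    simp [word, Algebra.TensorProduct.one_def]
  | cons g l ih =>
    have : comul (R := ℂ) (word (g :: l)) =
        (incl L g ⊗ₜ[ℂ] 1 + 1 ⊗ₜ[ℂ] incl L g) * comul (R := ℂ) (word l) := by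
      rw [comul_eq, comul_eq, ← coproduct_incl, ← map_mul]
      simp [word]
    rw [this]
    generalize comul (R := ℂ) (word l) = w at ih
    induction ih using Submodule.span_induction with
    | mem z hz =>
      obtain ⟨l₁, l₂, h, rfl⟩ := hz
      rw [add_mul, Algebra.TensorProduct.tmul_mul_tmul, Algebra.TensorProduct.tmul_mul_tmul]
      refine Submodule.add_mem _ (Submodule.subset_span ⟨g :: l₁, l₂, ?_, ?_⟩)
        (Submodule.subset_span ⟨l₁, g :: l₂, ?_, ?_⟩)
      · simp; omega
      · simp [word]
      · simp; omega
      · simp [word]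
    | zero => simp
    | add a b _ _ ha hb => rw [mul_add]; exact Submodule.add_mem _ ha hb
    | smul c a _ ha => rw [mul_smul_comm]; exact Submodule.smul_mem _ _ ha

/-- The `n`-th convolution power `u ⋆ ⋯ ⋆ u`. -/
def convPow (u : U L →ₗ[ℂ] U L) (n : ℕ) : U L →ₗ[ℂ] U L := (WithConv.toConv u ^ n).ofConv

theorem convPow_word (u : U L →ₗ[ℂ] U L) (hu : u 1 = 0) (n : ℕ) (l : List L)
    (h : l.length < n) : convPow u n (word l) = 0 := by
  induction n generalizing l with
  | zero => omega
  | succ n ih =>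
    have e : convPow u (n + 1) (word l) =
        LinearMap.mul' ℂ (U L) (TensorProduct.map u (convPow u n) (comul (R := ℂ) (word l))) := by
      simp only [convPow, pow_succ']
      rfl
    rw [e]
    have hw := comul_word l
    generalize comul (R := ℂ) (word l) = w at hw
    induction hw using Submodule.span_induction with
    | mem z hz =>
      obtain ⟨l₁, l₂, h12, rfl⟩ := hz
      rw [TensorProduct.map_tmul, LinearMap.mul'_apply]
      cases l₁ with
      | nil => simp [word, hu]
      | cons g l₁ =>
        rw [ih l₂ (by simp at h12; omega), mul_zero]
    | zero => simp
    | add a b _ _ ha hb => rw [map_add, map_add, ha, hb, add_zero]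
    | smul c a _ ha => rw [map_smul, map_smul, ha, smul_zero]

/-- Convolution powers of an endomorphism that kills `1` are locally nilpotent. -/
theorem exists_convPow_eq_zero (u : U L →ₗ[ℂ] U L) (hu : u 1 = 0) (x : U L) :
    ∃ N, ∀ n, N ≤ n → convPow u n x = 0 := by
  have hx : x ∈ Submodule.span ℂ (Set.range (word : List L → U L)) := by rw [span_word]; trivial
  induction hx using Submodule.span_induction with
  | mem z hz =>
    obtain ⟨l, rfl⟩ := hz
    exact ⟨l.length + 1, fun n hn => convPow_word u hu n l (by omega)⟩
  | zero => exact ⟨0, fun n _ => map_zero _⟩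
  | add a b _ _ ha hb =>
    obtain ⟨N, hN⟩ := ha
    obtain ⟨M, hM⟩ := hb
    exact ⟨max N M, fun n hn => by
      rw [map_add, hN n (le_trans (le_max_left _ _) hn), hM n (le_trans (le_max_right _ _) hn),
        add_zero]⟩
  | smul c a _ ha =>
    obtain ⟨N, hN⟩ := ha
    exact ⟨N, fun n hn => by rw [map_smul, hN n hn, smul_zero]⟩

theorem support_finite (u : U L →ₗ[ℂ] U L) (hu : u 1 = 0) (c : ℕ → ℂ) (k : ℕ) (x : U L) :
    (Function.support fun n => c n • convPow u (n + k) x).Finite := by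
  obtain ⟨N, hN⟩ := exists_convPow_eq_zero u hu x
  refine (Set.finite_lt_nat N).subset fun n hn => ?_
  by_contra h
  exact hn (by simp [hN (n + k) (by simp at h; omega)])

/-- The series `∑ₙ cₙ u^{⋆ (n + k)}` for `u` with `u 1 = 0`: at each `x` the sum is finite. -/
def convSeries (u : U L →ₗ[ℂ] U L) (hu : u 1 = 0) (c : ℕ → ℂ) (k : ℕ) : U L →ₗ[ℂ] U L where
  toFun x := ∑ᶠ n, c n • convPow u (n + k) x
  map_add' x y := by
    rw [← finsum_add_distrib (support_finite u hu c k x) (support_finite u hu c k y)]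
    simp
  map_smul' a x := by
    rw [RingHom.id_apply, smul_finsum' _ (support_finite u hu c k x)]
    simp [smul_comm a]

variable (L) in
/-- `Id - η ε`. -/
def augProj : U L →ₗ[ℂ] U L :=
  LinearMap.id - Algebra.linearMap ℂ (U L) ∘ₗ (augmentation L).toLinearMap

theorem augProj_one : augProj L (1 : U L) = 0 := by simp [augProj]

variable (L) in
/-- The Eulerian idempotent `pr = log⋆(Id) = ∑_{k ≥ 0} (-1)^k / (k + 1) (Id - η ε)^{⋆ (k + 1)}`. -/
def pr : U L →ₗ[ℂ] U L :=
  convSeries (augProj L) augProj_one (fun k => (-1) ^ k / (k + 1)) 1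

theorem pr_one : pr L 1 = 0 := by
  change ∑ᶠ n, _ = _
  refine finsum_eq_zero_of_forall_eq_zero fun n => ?_
  rw [show (1 : U L) = word [] by simp [word], convPow_word _ augProj_one _ _ (by simp), smul_zero]

/-- `φ_t = ∑_{n ≥ 0} tⁿ / n! pr^{⋆ n}`. -/
def phi (t : ℂ) : U L →ₗ[ℂ] U L :=
  convSeries (pr L) pr_one (fun n => t ^ n / (n.factorial : ℂ)) 0

/-- `A_t(x, g) = ∑ φ_{-t}(x⁽¹⁾) φ_t(x⁽²⁾ g)`, as a linear map in `x`. -/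
def A (t : ℂ) (g : L) : U L →ₗ[ℂ] U L :=
  LinearMap.mul' ℂ (U L) ∘ₗ
    TensorProduct.map (phi (-t)) (phi t ∘ₗ LinearMap.mulRight ℂ (incl L g)) ∘ₗ comul

theorem A_add (t : ℂ) (g h : L) : A t (g + h) = A t g + A t h := by
  have : LinearMap.mulRight ℂ (incl L (g + h)) =
      LinearMap.mulRight ℂ (incl L g) + LinearMap.mulRight ℂ (incl L h) := by
    ext x; simp [mul_add]
  simp only [A, this, LinearMap.comp_add, TensorProduct.map_add_right, LinearMap.add_comp]

theorem A_smul (t c : ℂ) (g : L) : A t (c • g) = c • A t g := by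
  have : LinearMap.mulRight ℂ (incl L (c • g)) = c • LinearMap.mulRight ℂ (incl L g) := by
    ext x; simp
  simp only [A, this, LinearMap.comp_smul, TensorProduct.map_smul_right, LinearMap.smul_comp]

variable (L) in
/-- A linear retraction of `L → U L`; on the image of `L` it is the inverse of this embedding. -/
def toLie : U L →ₗ[ℂ] L := (incl L).leftInverse

/-- The linear form `a ⊗ b ⊗ c ↦ f(a, b, c)`. -/
def triLin (f : L [⋀^Fin 3]→ₗ[ℂ] ℂ) : L ⊗[ℂ] (L ⊗[ℂ] L) →ₗ[ℂ] ℂ :=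
  TensorProduct.lift
    { toFun := fun a => TensorProduct.lift (LinearMap.mk₂ ℂ (fun b c => f ![a, b, c])
        (fun b b' c => congrArg (fun h : L [⋀^Fin 1]→ₗ[ℂ] ℂ => h ![c])
          (map_add (f.curryLeft a).curryLeft b b'))
        (fun r b c => congrArg (fun h : L [⋀^Fin 1]→ₗ[ℂ] ℂ => h ![c])
          (map_smul (f.curryLeft a).curryLeft r b))
        (fun b c c' => congrArg (fun h : L [⋀^Fin 0]→ₗ[ℂ] ℂ => h ![])
          (map_add ((f.curryLeft a).curryLeft b).curryLeft c c'))
        (fun r b c => congrArg (fun h : L [⋀^Fin 0]→ₗ[ℂ] ℂ => h ![])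
          (map_smul ((f.curryLeft a).curryLeft b).curryLeft r c)))
      map_add' := fun a a' => TensorProduct.ext' fun b c =>
        congrArg (fun h : L [⋀^Fin 2]→ₗ[ℂ] ℂ => h ![b, c]) (map_add f.curryLeft a a')
      map_smul' := fun r a => TensorProduct.ext' fun b c =>
        congrArg (fun h : L [⋀^Fin 2]→ₗ[ℂ] ℂ => h ![b, c]) (map_smul f.curryLeft r a) }

theorem triLin_tmul (f : L [⋀^Fin 3]→ₗ[ℂ] ℂ) (a b c : L) :
    triLin f (a ⊗ₜ[ℂ] (b ⊗ₜ[ℂ] c)) = f ![a, b, c] := rfl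

/-- `x ↦ ∑ f(pr(x⁽¹⁾), A_t(x⁽²⁾, g₁), A_t(x⁽³⁾, g₂))`, where elements of `U L` that lie in `L` are
regarded as elements of `L`. -/
def integrand (f : L [⋀^Fin 3]→ₗ[ℂ] ℂ) (t : ℂ) (g₁ g₂ : L) : U L →ₗ[ℂ] ℂ :=
  triLin f ∘ₗ
    TensorProduct.map (toLie L ∘ₗ pr L)
      (TensorProduct.map (toLie L ∘ₗ A t g₁) (toLie L ∘ₗ A t g₂)) ∘ₗ
    LinearMap.lTensor (U L) comul ∘ₗ comul

/-- Functions of `t` that are polynomial with coefficients in `W`. -/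
def polyFun (W : Type*) [AddCommGroup W] [Module ℂ W] : Submodule ℂ (ℂ → W) :=
  Submodule.span ℂ {F | ∃ (n : ℕ) (w : W), F = fun t => t ^ n • w}

section polyFun

variable {W W' W'' : Type*} [AddCommGroup W] [Module ℂ W] [AddCommGroup W'] [Module ℂ W']
  [AddCommGroup W''] [Module ℂ W'']

theorem polyFun_zero : (fun _ : ℂ => (0 : W)) ∈ polyFun W := (polyFun W).zero_mem

theorem polyFun_add {F G : ℂ → W} (hF : F ∈ polyFun W) (hG : G ∈ polyFun W) :
    (fun t => F t + G t) ∈ polyFun W := (polyFun W).add_mem hF hG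

theorem polyFun_smul (c : ℂ) {F : ℂ → W} (hF : F ∈ polyFun W) :
    (fun t => c • F t) ∈ polyFun W := (polyFun W).smul_mem c hF

theorem monomial_mem (n : ℕ) (w : W) : (fun t : ℂ => t ^ n • w) ∈ polyFun W :=
  Submodule.subset_span ⟨n, w, rfl⟩

theorem polyFun_comp (l : W →ₗ[ℂ] W') {F : ℂ → W} (hF : F ∈ polyFun W) :
    (fun t => l (F t)) ∈ polyFun W' := by
  induction hF using Submodule.span_induction with
  | mem F h =>
    obtain ⟨n, w, rfl⟩ := h
    simpa using monomial_mem n (l w)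
  | zero => simpa using polyFun_zero
  | add a b _ _ ha hb => simpa using polyFun_add ha hb
  | smul c a _ ha => simpa using polyFun_smul c ha

theorem polyFun_bilin (l : W →ₗ[ℂ] W' →ₗ[ℂ] W'') {F : ℂ → W} {G : ℂ → W'} (hF : F ∈ polyFun W)
    (hG : G ∈ polyFun W') : (fun t => l (F t) (G t)) ∈ polyFun W'' := by
  induction hF using Submodule.span_induction with
  | mem F h =>
    obtain ⟨n, w, rfl⟩ := h
    induction hG using Submodule.span_induction with
    | mem G h =>
      obtain ⟨m, w', rfl⟩ := h
      simpa [smul_smul, ← pow_add] using monomial_mem (m + n) (l w w')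
    | zero => simpa using polyFun_zero
    | add a b _ _ ha hb => simpa using polyFun_add ha hb
    | smul c a _ ha =>
      have := (polyFun W'').smul_mem c ha
      refine (congrArg (· ∈ polyFun W'') (funext fun t => ?_)).mp this
      simp [smul_comm c]
  | zero => simpa using polyFun_zero
  | add a b _ _ ha hb => simpa using polyFun_add ha hb
  | smul c a _ ha => simpa using polyFun_smul c ha

theorem polyFun_continuous {F : ℂ → ℂ} (hF : F ∈ polyFun ℂ) : Continuous F := by
  induction hF using Submodule.span_induction with
  | mem F h =>
    obtain ⟨n, w, rfl⟩ := h
    fun_prop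
  | zero => exact continuous_const
  | add a b _ _ ha hb => exact ha.add hb
  | smul c a _ ha => exact ha.const_smul c

end polyFun

theorem phi_polyFun (x : U L) : (fun t => phi t x) ∈ polyFun (U L) := by
  obtain ⟨N, hN⟩ := exists_convPow_eq_zero (pr L) pr_one x
  have : (fun t => phi t x) = ∑ n ∈ Finset.range N,
      fun t : ℂ => t ^ n • ((n.factorial : ℂ)⁻¹ • convPow (pr L) n x) := by
    funext t
    change ∑ᶠ n, _ = _
    rw [finsum_eq_sum_of_support_subset (s := Finset.range N)]
    · simp [smul_smul, div_eq_mul_inv]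
    · intro n hn
      by_contra h
      exact hn (by simp [hN n (by simpa using h)])
  rw [this]
  exact Submodule.sum_mem _ fun n _ => monomial_mem n _

theorem phi_neg_polyFun (x : U L) : (fun t => phi (-t) x) ∈ polyFun (U L) := by
  obtain ⟨N, hN⟩ := exists_convPow_eq_zero (pr L) pr_one x
  have : (fun t => phi (-t) x) = ∑ n ∈ Finset.range N,
      fun t : ℂ => t ^ n • (((-1) ^ n * (n.factorial : ℂ)⁻¹) • convPow (pr L) n x) := by
    funext t
    change ∑ᶠ n, _ = _
    rw [finsum_eq_sum_of_support_subset (s := Finset.range N)]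
    · simp only [Finset.sum_apply, smul_smul, div_eq_mul_inv, add_zero]
      refine Finset.sum_congr rfl fun n _ => ?_
      congr 1
      rw [neg_pow]; ring
    · intro n hn
      by_contra h
      exact hn (by simp [hN n (by simpa using h)])
  rw [this]
  exact Submodule.sum_mem _ fun n _ => monomial_mem n _

theorem A_polyFun (g : L) (x : U L) : (fun t => A t g x) ∈ polyFun (U L) := by
  have : ∀ z : U L ⊗[ℂ] U L, (fun t => LinearMap.mul' ℂ (U L) (TensorProduct.map (phi (-t))
      (phi t ∘ₗ LinearMap.mulRight ℂ (incl L g)) z)) ∈ polyFun (U L) := by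
    intro z
    induction z using TensorProduct.induction_on with
    | zero => simpa using polyFun_zero
    | tmul a b =>
      exact polyFun_bilin (LinearMap.mul ℂ (U L)) (phi_neg_polyFun a)
        (phi_polyFun (b * incl L g))
    | add a b ha hb => simpa using polyFun_add ha hb
  exact this (comul x)

theorem integrand_polyFun (f : L [⋀^Fin 3]→ₗ[ℂ] ℂ) (g₁ g₂ : L) (x : U L) :
    (fun t => integrand f t g₁ g₂ x) ∈ polyFun ℂ := by
  have h2 : ∀ (a : U L) (z : U L ⊗[ℂ] U L), (fun t => triLin f (TensorProduct.map (toLie L ∘ₗ pr L)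
      (TensorProduct.map (toLie L ∘ₗ A t g₁) (toLie L ∘ₗ A t g₂)) (a ⊗ₜ[ℂ] z))) ∈ polyFun ℂ := by
    intro a z
    induction z using TensorProduct.induction_on with
    | zero => simpa using polyFun_zero
    | tmul b c =>
      exact polyFun_comp (triLin f ∘ₗ TensorProduct.mk ℂ L (L ⊗[ℂ] L) (toLie L (pr L a)))
        (polyFun_bilin (TensorProduct.mk ℂ L L) (polyFun_comp (toLie L) (A_polyFun g₁ b))
          (polyFun_comp (toLie L) (A_polyFun g₂ c)))
    | add a b ha hb => simpa [tmul_add] using polyFun_add ha hb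
  have h3 : ∀ z : U L ⊗[ℂ] (U L ⊗[ℂ] U L), (fun t => triLin f
      (TensorProduct.map (toLie L ∘ₗ pr L)
      (TensorProduct.map (toLie L ∘ₗ A t g₁) (toLie L ∘ₗ A t g₂)) z)) ∈ polyFun ℂ := by
    intro z
    induction z using TensorProduct.induction_on with
    | zero => simpa using polyFun_zero
    | tmul a b => exact h2 a b
    | add a b ha hb => simpa using polyFun_add ha hb
  exact h3 _

theorem integrand_integrable (f : L [⋀^Fin 3]→ₗ[ℂ] ℂ) (g₁ g₂ : L) (x : U L) :
    IntervalIntegrable (fun t : ℝ => integrand f (t : ℂ) g₁ g₂ x) MeasureTheory.volume 0 1 :=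
  ((polyFun_continuous (integrand_polyFun f g₁ g₂ x)).comp
    Complex.continuous_ofReal).intervalIntegrable 0 1

theorem integrand_add_left (f : L [⋀^Fin 3]→ₗ[ℂ] ℂ) (t : ℂ) (g g' h : L) :
    integrand f t (g + g') h = integrand f t g h + integrand f t g' h := by
  simp only [integrand, A_add, LinearMap.comp_add, TensorProduct.map_add_left,
    TensorProduct.map_add_right, LinearMap.add_comp]

theorem integrand_smul_left (f : L [⋀^Fin 3]→ₗ[ℂ] ℂ) (t c : ℂ) (g h : L) :
    integrand f t (c • g) h = c • integrand f t g h := by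
  simp only [integrand, A_smul, LinearMap.comp_smul, TensorProduct.map_smul_left,
    TensorProduct.map_smul_right, LinearMap.smul_comp]

theorem integrand_swap (f : L [⋀^Fin 3]→ₗ[ℂ] ℂ) (t : ℂ) (g h : L) :
    integrand f t g h = -integrand f t h g := by
  have h3 : ∀ z : U L ⊗[ℂ] (U L ⊗[ℂ] U L), triLin f
      (TensorProduct.map (toLie L ∘ₗ pr L)
      (TensorProduct.map (toLie L ∘ₗ A t g) (toLie L ∘ₗ A t h)) z) = - triLin f
      (TensorProduct.map (toLie L ∘ₗ pr L)
      (TensorProduct.map (toLie L ∘ₗ A t h) (toLie L ∘ₗ A t g))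
        (LinearMap.lTensor (U L) (TensorProduct.comm ℂ (U L) (U L)).toLinearMap z)) := by
    intro z
    induction z using TensorProduct.induction_on with
    | zero => simp
    | tmul a w =>
      induction w using TensorProduct.induction_on with
      | zero => simp
      | tmul b c =>
        simp only [TensorProduct.map_tmul, LinearMap.lTensor_tmul, LinearEquiv.coe_coe,
          TensorProduct.comm_tmul, triLin_tmul, LinearMap.comp_apply]
        generalize toLie L (pr L a) = p
        generalize toLie L (A t g b) = q
        generalize toLie L (A t h c) = r
        have := f.map_swap ![p, r, q] (i := 1) (j := 2) (by decide)
        rw [← this]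
        congr 1
        funext k
        fin_cases k <;> rfl
      | add a b ha hb => simp only [tmul_add, map_add, ha, hb, neg_add]
    | add a b ha hb => simp only [map_add, ha, hb, neg_add]
  ext x
  have hc : LinearMap.lTensor (U L) (TensorProduct.comm ℂ (U L) (U L)).toLinearMap
      (LinearMap.lTensor (U L) comul (comul (R := ℂ) x)) =
      LinearMap.lTensor (U L) comul (comul (R := ℂ) x) := by
    rw [← LinearMap.comp_apply, ← LinearMap.lTensor_comp, Coalgebra.comm_comp_comul]
  have := h3 (LinearMap.lTensor (U L) comul (comul (R := ℂ) x))
  rw [hc] at this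
  exact this

variable (L) in
/-- The augmentation ideal `U L⁺ = ker ε`. -/
abbrev UPlus : Submodule ℂ (U L) := LinearMap.ker (augmentation L).toLinearMap

theorem mul_incl_mem (x : UPlus L) (g : L) : (x : U L) * incl L g ∈ UPlus L := by
  simp [augmentation_incl]

/-- The full linear dual `(U L)^∨`. -/
def UDual (L : Type*) [LieRing L] [LieAlgebra ℂ L] : Type _ := Module.Dual ℂ (U L)

/-- The full linear dual `(U L⁺)^∨`. -/
def UPlusDual (L : Type*) [LieRing L] [LieAlgebra ℂ L] : Type _ := Module.Dual ℂ (UPlus L)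

instance : AddCommGroup (UDual L) := inferInstanceAs (AddCommGroup (Module.Dual ℂ (U L)))
instance : Module ℂ (UDual L) := inferInstanceAs (Module ℂ (Module.Dual ℂ (U L)))
instance : AddCommGroup (UPlusDual L) := inferInstanceAs (AddCommGroup (Module.Dual ℂ (UPlus L)))
instance : Module ℂ (UPlusDual L) := inferInstanceAs (Module ℂ (Module.Dual ℂ (UPlus L)))

variable (L) in
/-- Elements of `UDual L` are linear forms on `U L`. -/
def UDual.equiv : UDual L ≃ₗ[ℂ] Module.Dual ℂ (U L) := LinearEquiv.refl ℂ _

variable (L) in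
/-- Elements of `UPlusDual L` are linear forms on `U L⁺`. -/
def UPlusDual.equiv : UPlusDual L ≃ₗ[ℂ] Module.Dual ℂ (UPlus L) := LinearEquiv.refl ℂ _

instance : CoeFun (UDual L) (fun _ => U L → ℂ) := ⟨fun ψ => UDual.equiv L ψ⟩
instance : CoeFun (UPlusDual L) (fun _ => UPlus L → ℂ) := ⟨fun ψ => UPlusDual.equiv L ψ⟩

theorem UDual.ext {ψ χ : UDual L} (h : ∀ x, ψ x = χ x) : ψ = χ := LinearMap.ext h

theorem UPlusDual.ext {ψ χ : UPlusDual L} (h : ∀ x, ψ x = χ x) : ψ = χ := LinearMap.ext h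

/-- Right multiplication by `g : L` on `U L⁺`. -/
def mulRightPlus (g : L) : UPlus L →ₗ[ℂ] UPlus L :=
  (LinearMap.mulRight ℂ (incl L g)).restrict fun x hx => mul_incl_mem ⟨x, hx⟩ g

theorem coe_mulRightPlus (g : L) (x : UPlus L) :
    (mulRightPlus g x : U L) = (x : U L) * incl L g := rfl

/-- The action `(g · ψ)(x) = ψ(x g)` of `L` on `(U L)^∨`. -/
instance : LieRingModule L (UDual L) where
  bracket g ψ := (UDual.equiv L).symm (UDual.equiv L ψ ∘ₗ LinearMap.mulRight ℂ (incl L g))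
  add_lie g h ψ := UDual.ext fun x => by
    change ψ (x * incl L (g + h)) = ψ (x * incl L g) + ψ (x * incl L h)
    rw [map_add, mul_add, map_add]
  lie_add g ψ χ := rfl
  leibniz_lie g h ψ := UDual.ext fun x => by
    change ψ (x * incl L g * incl L h) =
      ψ (x * incl L ⁅g, h⁆) + ψ (x * incl L h * incl L g)
    rw [incl_lie, mul_sub, map_sub, mul_assoc, mul_assoc]
    abel

theorem UDual.lie_apply (g : L) (ψ : UDual L) (x : U L) : ⁅g, ψ⁆ x = ψ (x * incl L g) := rfl

instance : LieModule ℂ L (UDual L) where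
  smul_lie c g ψ := UDual.ext fun x => by
    change ψ (x * incl L (c • g)) = c • ψ (x * incl L g)
    rw [map_smul, mul_smul_comm, map_smul]
  lie_smul c g ψ := rfl

/-- The action `(g · ψ)(x) = ψ(x g)` of `L` on `(U L⁺)^∨`. -/
instance : LieRingModule L (UPlusDual L) where
  bracket g ψ := (UPlusDual.equiv L).symm (UPlusDual.equiv L ψ ∘ₗ mulRightPlus g)
  add_lie g h ψ := UPlusDual.ext fun x => by
    change ψ (mulRightPlus (g + h) x) = ψ (mulRightPlus g x) + ψ (mulRightPlus h x)
    rw [← map_add]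
    congr 1
    ext
    simp [coe_mulRightPlus, mul_add]
  lie_add g ψ χ := rfl
  leibniz_lie g h ψ := UPlusDual.ext fun x => by
    change ψ (mulRightPlus h (mulRightPlus g x)) =
      ψ (mulRightPlus ⁅g, h⁆ x) + ψ (mulRightPlus g (mulRightPlus h x))
    rw [← map_add]
    congr 1
    ext
    simp [coe_mulRightPlus, incl_lie, mul_sub, mul_assoc]

theorem UPlusDual.lie_apply (g : L) (ψ : UPlusDual L) (x : UPlus L) :
    ⁅g, ψ⁆ x = ψ ⟨(x : U L) * incl L g, mul_incl_mem x g⟩ := rfl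

instance : LieModule ℂ L (UPlusDual L) where
  smul_lie c g ψ := UPlusDual.ext fun x => by
    change ψ (mulRightPlus (c • g) x) = c • ψ (mulRightPlus g x)
    rw [← map_smul]
    congr 1
    ext
    simp [coe_mulRightPlus]
  lie_smul c g ψ := rfl

/-- The trivial `L`-module `ℂ`. -/
abbrev Triv (L : Type*) [LieRing L] [LieAlgebra ℂ L] : Type := TrivialLieModule ℂ L ℂ

/-- The underlying complex number of an element of the trivial module. -/
abbrev Triv.val (c : Triv L) : ℂ := TrivialLieModule.equiv ℂ L ℂ c

variable (L) in
/-- The map `ℂ → (U L)^∨` dual to the augmentation: `c ↦ c ε`. -/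
def dualAug : Triv L →ₗ⁅ℂ,L⁆ UDual L where
  toFun c := (UDual.equiv L).symm (c.val • (augmentation L).toLinearMap)
  map_add' a b := UDual.ext fun x => add_mul a.val b.val (augmentation L x)
  map_smul' r a := UDual.ext fun x => mul_assoc r a.val (augmentation L x)
  map_lie' := by
    intro g c
    refine UDual.ext fun x => ?_
    rw [trivial_lie_zero]
    change (Triv.val (0 : Triv L)) * augmentation L x = c.val * augmentation L (x * incl L g)
    simp [augmentation_incl]

theorem dualAug_apply (c : Triv L) (x : U L) : dualAug L c x = c.val * augmentation L x := rfl

variable (L) in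
/-- The restriction map `(U L)^∨ → (U L⁺)^∨`. -/
def dualRes : UDual L →ₗ⁅ℂ,L⁆ UPlusDual L where
  toFun ψ := (UPlusDual.equiv L).symm (UDual.equiv L ψ ∘ₗ (UPlus L).subtype)
  map_add' _ _ := rfl
  map_smul' _ _ := rfl
  map_lie' := rfl

theorem dualRes_apply (ψ : UDual L) (x : UPlus L) : dualRes L ψ x = ψ (x : U L) := rfl

/-! The sequence `0 → ℂ → (U L)^∨ → (U L⁺)^∨ → 0` is exact. -/

theorem dualAug_injective : Function.Injective (dualAug L) := by
  intro a b h
  have h1 : dualAug L a (1 : U L) = dualAug L b (1 : U L) := by rw [h]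
  simpa [dualAug_apply] using h1

theorem dual_exact : Function.Exact (dualAug L) (dualRes L) := by
  intro ψ
  constructor
  · intro h
    refine ⟨(TrivialLieModule.equiv ℂ L ℂ).symm (ψ (1 : U L)), UDual.ext fun x => ?_⟩
    have hx : x - algebraMap ℂ (U L) (augmentation L x) ∈ UPlus L := by simp
    have h1 : dualRes L ψ ⟨_, hx⟩ = 0 := by rw [h]; rfl
    rw [dualRes_apply, map_sub, sub_eq_zero, Algebra.algebraMap_eq_smul_one, map_smul] at h1
    rw [dualAug_apply, h1, smul_eq_mul, mul_comm]
    simp [Triv.val]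
  · rintro ⟨c, rfl⟩
    refine UPlusDual.ext fun x => ?_
    rw [dualRes_apply, dualAug_apply, show augmentation L (x : U L) = 0 from x.2, mul_zero]
    rfl

theorem dualRes_surjective : Function.Surjective (dualRes L) := by
  intro χ
  obtain ⟨ψ, hψ⟩ := LinearMap.exists_extend (UPlusDual.equiv L χ)
  exact ⟨(UDual.equiv L).symm ψ, UPlusDual.ext fun x => by
    rw [dualRes_apply, ← hψ]; rfl⟩

/-- A scalar cochain as an alternating form. -/
abbrev toForm {n : ℕ} (f : Cochain L (Triv L) n) : L [⋀^Fin n]→ₗ[ℂ] ℂ :=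
  (TrivialLieModule.equiv ℂ L ℂ).toLinearMap.compAlternatingMap f

/-- The linear form `x ↦ ∑ ∫₀¹ f(pr(x⁽¹⁾), A_t(x⁽²⁾, g₁), A_t(x⁽³⁾, g₂)) dt` on `U L`. -/
def alphaForm (f : L [⋀^Fin 3]→ₗ[ℂ] ℂ) (g₁ g₂ : L) : Module.Dual ℂ (U L) where
  toFun x := ∫ t in (0 : ℝ)..1, integrand f (t : ℂ) g₁ g₂ x
  map_add' x y := by
    rw [← intervalIntegral.integral_add (integrand_integrable f g₁ g₂ x)
      (integrand_integrable f g₁ g₂ y)]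
    simp
  map_smul' c x := by
    rw [RingHom.id_apply, ← intervalIntegral.integral_smul]
    simp

theorem alphaForm_apply (f : L [⋀^Fin 3]→ₗ[ℂ] ℂ) (g₁ g₂ : L) (x : U L) :
    alphaForm f g₁ g₂ x = ∫ t in (0 : ℝ)..1, integrand f (t : ℂ) g₁ g₂ x := rfl

theorem alphaForm_swap (f : L [⋀^Fin 3]→ₗ[ℂ] ℂ) (g h : L) :
    alphaForm f g h = -alphaForm f h g := by
  ext x
  rw [LinearMap.neg_apply, alphaForm_apply, alphaForm_apply, ← intervalIntegral.integral_neg]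
  simp only [integrand_swap f _ g h, LinearMap.neg_apply]

theorem alphaForm_add_left (f : L [⋀^Fin 3]→ₗ[ℂ] ℂ) (g g' h : L) :
    alphaForm f (g + g') h = alphaForm f g h + alphaForm f g' h := by
  ext x
  rw [LinearMap.add_apply, alphaForm_apply, alphaForm_apply, alphaForm_apply,
    ← intervalIntegral.integral_add (integrand_integrable f g h x)
      (integrand_integrable f g' h x)]
  simp only [integrand_add_left, LinearMap.add_apply]

theorem alphaForm_smul_left (f : L [⋀^Fin 3]→ₗ[ℂ] ℂ) (c : ℂ) (g h : L) :
    alphaForm f (c • g) h = c • alphaForm f g h := by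
  ext x
  rw [LinearMap.smul_apply, alphaForm_apply, alphaForm_apply, ← intervalIntegral.integral_smul]
  simp only [integrand_smul_left, LinearMap.smul_apply]

/-- The cochain `α̃ ∈ C²(L; (U L)^∨)`,
`α̃(g₁, g₂)(x) = ∑ ∫₀¹ f(pr(x⁽¹⁾), A_t(x⁽²⁾, g₁), A_t(x⁽³⁾, g₂)) dt`. -/
def alphaTilde (f : Cochain L (Triv L) 3) : Cochain L (UDual L) 2 where
  toFun v := (UDual.equiv L).symm (alphaForm (toForm f) (v 0) (v 1))
  map_update_add' := by
    intro _ v i x y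
    rw [← map_add]
    congr 1
    fin_cases i
    · simp [alphaForm_add_left]
    · simp only [Fin.mk_one, alphaForm_swap (toForm f) (Function.update v 1 _ 0)]
      simp [alphaForm_add_left, add_comm]
  map_update_smul' := by
    intro _ v i c x
    rw [← map_smul]
    congr 1
    fin_cases i
    · simp [alphaForm_smul_left]
    · simp only [Fin.mk_one, alphaForm_swap (toForm f) (Function.update v 1 _ 0)]
      simp [alphaForm_smul_left]
  map_eq_zero_of_eq' := by
    intro v i j hv hij
    have h01 : v 0 = v 1 := by
      fin_cases i <;> fin_cases j <;> simp_all
    have h := alphaForm_swap (toForm f) (v 0) (v 1)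
    rw [h01] at h
    have h' : alphaForm (toForm f) (v 1) (v 1) = 0 := by
      ext x
      have := congrArg (fun a : Module.Dual ℂ (U L) => a x) h
      exact self_eq_neg.mp this
    rw [h01, h', map_zero]

theorem alphaTilde_apply (f : Cochain L (Triv L) 3) (v : Fin 2 → L) (x : U L) :
    alphaTilde f v x = ∫ t in (0 : ℝ)..1, integrand (toForm f) (t : ℂ) (v 0) (v 1) x := rfl

/-- The cochain `α ∈ C²(L; (U L⁺)^∨)`, the restriction of `α̃` to `U L⁺`. -/
def alpha (f : Cochain L (Triv L) 3) : Cochain L (UPlusDual L) 2 := push (dualRes L) (alphaTilde f)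

end EnvelopingLift

end

/-!
Regard `U L` as the coalgebra of distributions at the identity of the formal group of `L`. Linear
maps from `U L` to a vector space are then functions on this group, their convolution products are
pointwise products, and `g : L` acts on them, through right multiplication by `g` on `U L`, as a
left invariant vector field. In this language `phi t` is the contraction `x ↦ exp (t log x)`, the pair
`pr dt + A_t` is the pullback of the Maurer-Cartan form along it, and `α̃` is the primitive of the
invariant form `f` which the Poincaré lemma attaches to the contraction. The formula for `d α̃` is
Cartan's homotopy formula: with `A = A_t`, the derivative in `t` of `f(A, A, A)` is the differential
of `f(pr, A, A)`, because `f` is a cocycle and `A` is flat (`hasConvDeriv_convForm`). Integrating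
over `[0, 1]` gives `ε f`, since `A₀ = 0` and `A₁(g) = ε g`.

This uses that the canonical map `L → U L` is injective and that `pr` and `A_t` have values in `L`.
Mathlib does not have the Poincaré-Birkhoff-Witt theorem, and the following argument produces what
is needed. On the symmetric coalgebra of `L`, with projection `p` to `L`, put
`A_t(g) = ((1 - exp (-t ad p)) / ad p) a_g`, where `a_g = (ad p / (1 - exp (-ad p))) g`, and let `g`
act by the coderivation `D_g` with `p ∘ D_g = a_g`. Then `A' = p ∘ D_g + [A, p]`, `A₀ = 0` and
`A₁(g) = ε g`. The curvature `F` of `A` satisfies `F' = R + [F, p]`, where `R` is the failure of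
`D` to be an action of `L`, evaluated on `p`. As `F` vanishes at `t = 0` and at `t = 1`, and `p` is
nilpotent for convolution, `R = 0` (`IsContraction.source_eq_zero`). So `L` acts on the symmetric
coalgebra (`symAct_lie`), and acting on `1` gives a map of coalgebras from `U L` to it. Along this
map `p` and `A_t` pull back to `L`-valued functions `logProj` and `logForm` on `U L` which satisfy
the same equations (`isContraction_log`). Since `logProj` restricts to the identity of `L`, the
Lie algebra embeds in `U L`. Finally `exp (t logProj)` is the contraction belonging to `logForm`
(`expLog_comp_mulRight`); at `t = 1` it is the identity, so that `logProj` is the logarithm `pr` of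
the identity, and `logForm` is `A_t`.
-/

noncomputable section

open TensorProduct Coalgebra

/-! ### Convolution on a coalgebra -/

namespace CoalgConv

variable {C V V' W X : Type*} [AddCommGroup C] [Module ℂ C]
  [AddCommGroup V] [Module ℂ V] [AddCommGroup V'] [Module ℂ V'] [AddCommGroup W] [Module ℂ W]
  [AddCommGroup X] [Module ℂ X]

/-- The map `a ⊗ b ⊗ c ↦ G(a)(u(b), v(c))` on the triple tensor product. -/
def tri (G : C →ₗ[ℂ] V →ₗ[ℂ] V' →ₗ[ℂ] W) (u : C →ₗ[ℂ] V) (v : C →ₗ[ℂ] V') :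
    C ⊗[ℂ] (C ⊗[ℂ] C) →ₗ[ℂ] W :=
  TensorProduct.lift ((TensorProduct.uncurry (RingHom.id ℂ) V V' W) ∘ₗ G) ∘ₗ
    LinearMap.lTensor C (TensorProduct.map u v)

theorem tri_tmul (G : C →ₗ[ℂ] V →ₗ[ℂ] V' →ₗ[ℂ] W) (u : C →ₗ[ℂ] V) (v : C →ₗ[ℂ] V')
    (a b c : C) : tri G u v (a ⊗ₜ (b ⊗ₜ c)) = G a (u b) (v c) := by
  simp [tri]

variable [Coalgebra ℂ C]

/-- The convolution `x ↦ ∑ G(x⁽¹⁾)(u(x⁽²⁾))` of a map `G` on a coalgebra whose values are linear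
maps `V → W` with a `V`-valued map `u`. -/
def app : (C →ₗ[ℂ] V →ₗ[ℂ] W) →ₗ[ℂ] (C →ₗ[ℂ] V) →ₗ[ℂ] (C →ₗ[ℂ] W) :=
  LinearMap.mk₂ ℂ (fun G u => TensorProduct.lift (G.compl₂ u) ∘ₗ comul)
    (fun G G' u => by ext x; simp [← (ℛ ℂ x).eq, Finset.sum_add_distrib])
    (fun c G u => by ext x; simp [← (ℛ ℂ x).eq, Finset.smul_sum])
    (fun G u u' => by ext x; simp [← (ℛ ℂ x).eq, Finset.sum_add_distrib])
    (fun c G u => by ext x; simp [← (ℛ ℂ x).eq, Finset.smul_sum])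

theorem app_apply (G : C →ₗ[ℂ] V →ₗ[ℂ] W) (u : C →ₗ[ℂ] V) (x : C) :
    app G u x = TensorProduct.lift (G.compl₂ u) (comul x) := rfl

theorem app_repr (G : C →ₗ[ℂ] V →ₗ[ℂ] W) (u : C →ₗ[ℂ] V) (x : C) :
    app G u x = ∑ i ∈ (ℛ ℂ x).index, G ((ℛ ℂ x).left i) (u ((ℛ ℂ x).right i)) := by
  rw [app_apply, ← (ℛ ℂ x).eq]; simp

theorem comp_app (l : W →ₗ[ℂ] X) (G : C →ₗ[ℂ] V →ₗ[ℂ] W) (u : C →ₗ[ℂ] V) :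
    l ∘ₗ app G u = app (LinearMap.llcomp ℂ V W X l ∘ₗ G) u := by
  ext x; simp [app_repr]

theorem app_comp (G : C →ₗ[ℂ] V →ₗ[ℂ] W) (l : V' →ₗ[ℂ] V) (u : C →ₗ[ℂ] V') :
    app G (l ∘ₗ u) = app (LinearMap.lcomp ℂ W l ∘ₗ G) u := by
  ext x; simp [app_repr]

theorem app_app_eq_tri (G : C →ₗ[ℂ] V →ₗ[ℂ] V' →ₗ[ℂ] W) (u : C →ₗ[ℂ] V) (v : C →ₗ[ℂ] V')
    (x : C) : app (app G u) v x = tri G u v (LinearMap.lTensor C comul (comul x)) := by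
  rw [← coassoc_apply, app_apply]
  generalize comul (R := ℂ) x = z
  induction z using TensorProduct.induction_on with
  | zero => simp
  | add a b ha hb => simp only [map_add, ha, hb]
  | tmul a b =>
    simp only [TensorProduct.lift.tmul, LinearMap.compl₂_apply, app_apply, LinearMap.rTensor_tmul]
    generalize comul (R := ℂ) a = z
    induction z using TensorProduct.induction_on with
    | zero => simp
    | add a b ha hb => simp only [map_add, add_tmul, LinearMap.add_apply, ha, hb]
    | tmul c d => simp [tri_tmul]

/-- Associativity of convolution. -/
theorem app_app (G : C →ₗ[ℂ] W →ₗ[ℂ] X) (H : C →ₗ[ℂ] V →ₗ[ℂ] W) (v : C →ₗ[ℂ] V) :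
    app G (app H v) = app (app (LinearMap.llcomp ℂ V W X ∘ₗ G) H) v := by
  ext x
  rw [app_app_eq_tri, app_apply]
  generalize comul (R := ℂ) x = z
  induction z using TensorProduct.induction_on with
  | zero => simp
  | add a b ha hb => simp only [map_add, ha, hb]
  | tmul a b =>
    simp only [TensorProduct.lift.tmul, LinearMap.compl₂_apply, app_apply, LinearMap.lTensor_tmul]
    generalize comul (R := ℂ) b = z
    induction z using TensorProduct.induction_on with
    | zero => simp
    | add a b ha hb => simp only [map_add, tmul_add, ha, hb]
    | tmul c d => simp [tri_tmul]

/-- The map `x ↦ ε(x) w`. -/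
def const (w : W) : C →ₗ[ℂ] W := LinearMap.toSpanSingleton ℂ W w ∘ₗ counit

theorem const_apply (w : W) (x : C) : const w x = counit (R := ℂ) x • w := rfl

theorem const_add (v w : W) : (const (v + w) : C →ₗ[ℂ] W) = const v + const w := by
  ext x; simp [const_apply]

theorem const_smul (c : ℂ) (w : W) : (const (c • w) : C →ₗ[ℂ] W) = c • const w := by
  ext x; simp [const_apply, smul_comm c]

theorem comp_const (l : V →ₗ[ℂ] W) (v : V) : l ∘ₗ (const v : C →ₗ[ℂ] V) = const (l v) := by
  ext; simp [const_apply]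

theorem app_const_left (l : V →ₗ[ℂ] W) (u : C →ₗ[ℂ] V) : app (const l) u = l ∘ₗ u := by
  ext x
  have := sum_counit_smul (ℛ ℂ x)
  conv_rhs => rw [← this]
  simp [app_repr, const_apply]

section Cocomm

variable [IsCocomm ℂ C]

/-- By cocommutativity the two factors of a convolution may be exchanged. -/
theorem app_comm (G : C →ₗ[ℂ] V →ₗ[ℂ] W) (u : C →ₗ[ℂ] V) :
    app G u = app (LinearMap.applyₗ ∘ₗ u) G := by
  ext x
  rw [app_apply, ← comm_comul, app_apply]
  generalize comul (R := ℂ) x = z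
  induction z using TensorProduct.induction_on with
  | zero => simp
  | add a b ha hb => simp only [map_add, ha, hb]
  | tmul a b => simp

theorem app_comp_flip (M : V →ₗ[ℂ] V' →ₗ[ℂ] W) (u : C →ₗ[ℂ] V) (v : C →ₗ[ℂ] V') :
    app (M ∘ₗ u) v = app (M.flip ∘ₗ v) u := by
  rw [app_comm, app_comp]; rfl

theorem app_const_right (G : C →ₗ[ℂ] V →ₗ[ℂ] W) (v : V) :
    app G (const v) = LinearMap.applyₗ v ∘ₗ G := by
  rw [app_comm, comp_const, app_const_left]

/-- The arguments of a bilinear convolution may be permuted along with those of `G`. -/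
theorem app_swap (G : C →ₗ[ℂ] V →ₗ[ℂ] V' →ₗ[ℂ] W) (u : C →ₗ[ℂ] V) (v : C →ₗ[ℂ] V') :
    app (app G u) v =
      app (app ((LinearMap.lflip : (V →ₗ[ℂ] V' →ₗ[ℂ] W) ≃ₗ[ℂ] _).toLinearMap ∘ₗ G) v) u := by
  ext x
  have hc : LinearMap.lTensor C (TensorProduct.comm ℂ C C).toLinearMap
      (LinearMap.lTensor C comul (comul (R := ℂ) x)) =
      LinearMap.lTensor C comul (comul (R := ℂ) x) := by
    rw [← LinearMap.comp_apply, ← LinearMap.lTensor_comp, Coalgebra.comm_comp_comul]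
  rw [app_app_eq_tri, app_app_eq_tri]
  conv_lhs => rw [← hc]
  generalize LinearMap.lTensor C comul (comul (R := ℂ) x) = z
  induction z using TensorProduct.induction_on with
  | zero => simp
  | add a b ha hb => simp only [map_add, ha, hb]
  | tmul a z =>
    induction z using TensorProduct.induction_on with
    | zero => simp
    | add a b ha hb => simp only [map_add, tmul_add, ha, hb]
    | tmul c d => simp [tri_tmul]

end Cocomm

/-- A coderivation of `C`: `Δ ∘ D = (D ⊗ 1 + 1 ⊗ D) ∘ Δ`. -/
def IsCoderivation (D : C →ₗ[ℂ] C) : Prop :=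
  ∀ x, comul (R := ℂ) (D x) = D.rTensor C (comul x) + D.lTensor C (comul x)

/-- Composition with a coderivation satisfies the Leibniz rule. -/
theorem IsCoderivation.app_comp {D : C →ₗ[ℂ] C} (hD : IsCoderivation D)
    (G : C →ₗ[ℂ] V →ₗ[ℂ] W) (u : C →ₗ[ℂ] V) :
    app G u ∘ₗ D = app (G ∘ₗ D) u + app G (u ∘ₗ D) := by
  ext x
  rw [LinearMap.comp_apply, app_apply, hD, LinearMap.add_apply, app_apply, app_apply, map_add]
  generalize comul (R := ℂ) x = z
  induction z using TensorProduct.induction_on with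
  | zero => simp
  | add a b ha hb =>
    simp only [map_add]
    rw [add_add_add_comm, ha, hb]; abel
  | tmul a b => simp

section LieBracket

variable {L : Type*} [LieRing L] [LieAlgebra ℂ L]

/-- The bracket `x ↦ ∑ [u(x⁽¹⁾), v(x⁽²⁾)]` of maps from a coalgebra to a Lie algebra. -/
def br : (C →ₗ[ℂ] L) →ₗ[ℂ] (C →ₗ[ℂ] L) →ₗ[ℂ] (C →ₗ[ℂ] L) :=
  app ∘ₗ LinearMap.llcomp ℂ C L (L →ₗ[ℂ] L) (LieModule.toEnd ℂ L L : L →ₗ[ℂ] L →ₗ[ℂ] L)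

theorem br_def (u v : C →ₗ[ℂ] L) :
    br u v = app ((LieModule.toEnd ℂ L L : L →ₗ[ℂ] L →ₗ[ℂ] L) ∘ₗ u) v := rfl

theorem IsCoderivation.br_comp {D : C →ₗ[ℂ] C} (hD : IsCoderivation D) (u v : C →ₗ[ℂ] L) :
    br u v ∘ₗ D = br (u ∘ₗ D) v + br u (v ∘ₗ D) := by
  rw [br_def, hD.app_comp]; rfl

theorem br_repr (u v : C →ₗ[ℂ] L) (x : C) :
    br u v x = ∑ i ∈ (ℛ ℂ x).index, ⁅u ((ℛ ℂ x).left i), v ((ℛ ℂ x).right i)⁆ := by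
  rw [br_def, app_repr]; rfl

variable [IsCocomm ℂ C]

theorem br_skew (u v : C →ₗ[ℂ] L) : br u v = -br v u := by
  rw [br_def, app_comp_flip, br_def, ← LinearMap.neg_apply, ← map_neg]
  congr 2
  ext x y
  exact (lie_skew _ _).symm

theorem br_const (x y : L) : br (const x : C →ₗ[ℂ] L) (const y) = const ⁅x, y⁆ := by
  rw [br_def, app_const_right, comp_const, comp_const]
  rfl

/-- The Jacobi identity for the convolution bracket. -/
theorem br_br (u v w : C →ₗ[ℂ] L) : br u (br v w) = br (br u v) w + br v (br u w) := by
  let ad : L →ₗ[ℂ] L →ₗ[ℂ] L := LieModule.toEnd ℂ L L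
  let M : L →ₗ[ℂ] L →ₗ[ℂ] L →ₗ[ℂ] L := LinearMap.lcomp ℂ _ ad ∘ₗ LinearMap.llcomp ℂ L L L ∘ₗ ad
  let N : L →ₗ[ℂ] L →ₗ[ℂ] L →ₗ[ℂ] L := LinearMap.llcomp ℂ L L (L →ₗ[ℂ] L) ad ∘ₗ ad
  have e1 : ∀ u v w : C →ₗ[ℂ] L, br u (br v w) = app (app (M ∘ₗ u) v) w := by
    intro u v w
    rw [br_def, br_def, app_app, app_comp]; rfl
  have e2 : br (br u v) w = app (app (N ∘ₗ u) v) w := by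
    rw [br_def, br_def, comp_app]; rfl
  have e3 : M = N + M.flip := by
    ext x y z
    exact leibniz_lie x y z
  rw [e1, e1, e2, app_comp_flip M v u, ← LinearMap.add_apply, ← map_add, ← LinearMap.add_apply,
    ← map_add, ← LinearMap.add_comp, ← e3]

end LieBracket

end CoalgConv

/-! ### Polynomial families and their derivatives -/

namespace CoalgConv

section PolyDeriv

variable {V W X : Type*} [AddCommGroup V] [Module ℂ V] [AddCommGroup W] [Module ℂ W]
  [AddCommGroup X] [Module ℂ X]

variable (W) in
/-- The pairs `(F, F')` of a polynomial function of `t` with coefficients in `W` and its formal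
derivative. -/
def polyDeriv : Submodule ℂ ((ℂ → W) × (ℂ → W)) :=
  Submodule.span ℂ {P | ∃ (n : ℕ) (w : W),
    P = (fun t => t ^ n • w, fun t => ((n : ℂ) * t ^ (n - 1)) • w)}

/-- `F` is a polynomial function of `t` with derivative `F'`. As `W` carries no topology, the
derivative is the formal one. -/
def HasPolyDeriv (F F' : ℂ → W) : Prop := (F, F') ∈ polyDeriv W

namespace HasPolyDeriv

theorem monomial (n : ℕ) (w : W) :
    HasPolyDeriv (fun t => t ^ n • w) (fun t => ((n : ℂ) * t ^ (n - 1)) • w) :=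
  Submodule.subset_span ⟨n, w, rfl⟩

theorem const (w : W) : HasPolyDeriv (fun _ => w) (fun _ => 0) := by
  simpa using monomial 0 w

theorem id_smul (w : W) : HasPolyDeriv (fun t => t • w) (fun _ => w) := by
  simpa using monomial 1 w

theorem add {F F' G G' : ℂ → W} (hF : HasPolyDeriv F F') (hG : HasPolyDeriv G G') :
    HasPolyDeriv (fun t => F t + G t) (fun t => F' t + G' t) := (polyDeriv W).add_mem hF hG

theorem sub {F F' G G' : ℂ → W} (hF : HasPolyDeriv F F') (hG : HasPolyDeriv G G') :
    HasPolyDeriv (fun t => F t - G t) (fun t => F' t - G' t) := (polyDeriv W).sub_mem hF hG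

theorem smul (c : ℂ) {F F' : ℂ → W} (hF : HasPolyDeriv F F') :
    HasPolyDeriv (fun t => c • F t) (fun t => c • F' t) := (polyDeriv W).smul_mem c hF

theorem sum {ι : Type*} (s : Finset ι) {F F' : ι → ℂ → W}
    (h : ∀ i ∈ s, HasPolyDeriv (F i) (F' i)) :
    HasPolyDeriv (fun t => ∑ i ∈ s, F i t) (fun t => ∑ i ∈ s, F' i t) := by
  have := (polyDeriv W).sum_mem h
  rw [HasPolyDeriv]
  convert this using 1
  ext <;> simp [Prod.fst_sum, Prod.snd_sum]

/-- The Leibniz rule. -/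
theorem bilin (B : V →ₗ[ℂ] W →ₗ[ℂ] X) {F F' : ℂ → V} {G G' : ℂ → W} (hF : HasPolyDeriv F F')
    (hG : HasPolyDeriv G G') :
    HasPolyDeriv (fun t => B (F t) (G t)) (fun t => B (F' t) (G t) + B (F t) (G' t)) := by
  suffices H : ∀ P ∈ polyDeriv V, ∀ Q ∈ polyDeriv W, HasPolyDeriv (fun t => B (P.1 t) (Q.1 t))
      (fun t => B (P.2 t) (Q.1 t) + B (P.1 t) (Q.2 t)) from H _ hF _ hG
  intro P hP Q hQ
  induction hP using Submodule.span_induction with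
  | mem P h =>
    obtain ⟨n, w, rfl⟩ := h
    induction hQ using Submodule.span_induction with
    | mem Q h =>
      obtain ⟨m, w', rfl⟩ := h
      convert monomial (n + m) (B w w') using 1
      · funext t
        simp [smul_smul, pow_add, mul_comm]
      · funext t
        simp only [map_smul, LinearMap.smul_apply, smul_smul, ← add_smul]
        congr 1
        rcases n with _ | n <;> rcases m with _ | m
        · simp
        · simp
        · simp
        · push_cast [Nat.add_sub_cancel, show n + 1 + (m + 1) - 1 = n + 1 + m by omega]
          ring
    | zero => simpa using const 0
    | add a b _ _ ha hb => convert ha.add hb using 1 <;> funext t <;> simp; abel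
    | smul c a _ ha =>
      convert ha.smul c using 1 <;> funext t <;> simp [smul_comm c]
  | zero => simpa using const 0
  | add a b _ _ ha hb => convert ha.add hb using 1 <;> funext t <;> simp; abel
  | smul c a _ ha =>
    convert ha.smul c using 1 <;> funext t <;> simp

theorem comp_linear (l : V →ₗ[ℂ] W) {F F' : ℂ → V} (hF : HasPolyDeriv F F') :
    HasPolyDeriv (fun t => l (F t)) (fun t => l (F' t)) := by
  simpa using bilin (LinearMap.id : (V →ₗ[ℂ] W) →ₗ[ℂ] V →ₗ[ℂ] W) (const l) hF

theorem hasDerivAt {F F' : ℂ → ℂ} (h : HasPolyDeriv F F') (t : ℂ) : HasDerivAt F (F' t) t := by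
  suffices H : ∀ P ∈ polyDeriv ℂ, HasDerivAt P.1 (P.2 t) t from H _ h
  intro P hP
  induction hP using Submodule.span_induction with
  | mem P h =>
    obtain ⟨n, w, rfl⟩ := h
    exact (hasDerivAt_pow n t).mul_const w
  | zero => exact hasDerivAt_const t 0
  | add a b _ _ ha hb => exact ha.add hb
  | smul c a _ ha => exact ha.const_smul c

theorem continuous_deriv {F F' : ℂ → ℂ} (h : HasPolyDeriv F F') : Continuous F' := by
  suffices H : ∀ P ∈ polyDeriv ℂ, Continuous P.2 from H _ h
  intro P hP
  induction hP using Submodule.span_induction with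
  | mem P h =>
    obtain ⟨n, w, rfl⟩ := h
    fun_prop
  | zero => exact continuous_const
  | add a b _ _ ha hb => exact ha.add hb
  | smul c a _ ha => exact ha.const_smul c

theorem integral {F F' : ℂ → ℂ} (h : HasPolyDeriv F F') :
    ∫ t in (0 : ℝ)..1, F' (t : ℂ) = F 1 - F 0 := by
  have := intervalIntegral.integral_eq_sub_of_hasDerivAt (a := 0) (b := 1)
    (f := fun t : ℝ => F t) (f' := fun t : ℝ => F' t) (fun t _ => (h.hasDerivAt t).comp_ofReal)
    ((h.continuous_deriv.comp Complex.continuous_ofReal).intervalIntegrable 0 1)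
  simpa using this

/-- A polynomial function with constant derivative is affine. Linear forms on `W` reduce this to
scalar functions. -/
theorem eq_of_const {F : ℂ → W} {w : W} (h : HasPolyDeriv F (fun _ => w)) (t : ℂ) :
    F t = F 0 + t • w := by
  rw [← sub_eq_zero, ← Module.forall_dual_apply_eq_zero_iff ℂ]
  intro l
  have h1 := (h.sub (id_smul w)).comp_linear l
  simp only [sub_self, map_zero] at h1
  have h2 := is_const_of_deriv_eq_zero (fun s => (h1.hasDerivAt s).differentiableAt)
    (fun s => (h1.hasDerivAt s).deriv) t 0
  simp only [zero_smul, sub_zero] at h2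
  rw [← sub_sub, sub_right_comm, map_sub, h2, sub_self]

end HasPolyDeriv

end PolyDeriv

section ConvDeriv

variable {C V W X : Type*} [AddCommGroup C] [Module ℂ C]
  [AddCommGroup V] [Module ℂ V] [AddCommGroup W] [Module ℂ W] [AddCommGroup X] [Module ℂ X]

/-- Pointwise version of `HasPolyDeriv` for families of linear maps on `C`; the degree in `t` may
depend on the point of `C`. -/
def HasConvDeriv (u u' : ℂ → C →ₗ[ℂ] W) : Prop :=
  ∀ x, HasPolyDeriv (fun t => u t x) (fun t => u' t x)

namespace HasConvDeriv

theorem const (u : C →ₗ[ℂ] W) : HasConvDeriv (fun _ => u) (fun _ => 0) :=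
  fun x => HasPolyDeriv.const (u x)

theorem add {u u' v v' : ℂ → C →ₗ[ℂ] W} (hu : HasConvDeriv u u') (hv : HasConvDeriv v v') :
    HasConvDeriv (fun t => u t + v t) (fun t => u' t + v' t) :=
  fun x => (hu x).add (hv x)

theorem sub {u u' v v' : ℂ → C →ₗ[ℂ] W} (hu : HasConvDeriv u u') (hv : HasConvDeriv v v') :
    HasConvDeriv (fun t => u t - v t) (fun t => u' t - v' t) :=
  fun x => (hu x).sub (hv x)

theorem comp_right {u u' : ℂ → C →ₗ[ℂ] W} (hu : HasConvDeriv u u') (D : C →ₗ[ℂ] C) :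
    HasConvDeriv (fun t => u t ∘ₗ D) (fun t => u' t ∘ₗ D) :=
  fun x => hu (D x)

theorem comp_left (l : V →ₗ[ℂ] W) {u u' : ℂ → C →ₗ[ℂ] V} (hu : HasConvDeriv u u') :
    HasConvDeriv (fun t => l ∘ₗ u t) (fun t => l ∘ₗ u' t) :=
  fun x => (hu x).comp_linear l

theorem congr {u u' u'' : ℂ → C →ₗ[ℂ] W} (hu : HasConvDeriv u u') (h : ∀ t, u' t = u'' t) :
    HasConvDeriv u u'' := by
  rwa [← show u' = u'' from funext h]

variable [Coalgebra ℂ C]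

/-- The Leibniz rule for convolution. -/
theorem conv_app {G G' : ℂ → C →ₗ[ℂ] V →ₗ[ℂ] W} {u u' : ℂ → C →ₗ[ℂ] V} (hG : HasConvDeriv G G')
    (hu : HasConvDeriv u u') :
    HasConvDeriv (fun t => app (G t) (u t)) (fun t => app (G' t) (u t) + app (G t) (u' t)) := by
  intro x
  simp only [LinearMap.add_apply, app_repr, ← Finset.sum_add_distrib]
  exact HasPolyDeriv.sum _ fun i _ => HasPolyDeriv.bilin LinearMap.id (hG _) (hu _)

theorem conv_br {L : Type*} [LieRing L] [LieAlgebra ℂ L] {u u' v v' : ℂ → C →ₗ[ℂ] L}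
    (hu : HasConvDeriv u u') (hv : HasConvDeriv v v') :
    HasConvDeriv (fun t => br (u t) (v t)) (fun t => br (u' t) (v t) + br (u t) (v' t)) :=
  conv_app (hu.comp_left (LieModule.toEnd ℂ L L : L →ₗ[ℂ] L →ₗ[ℂ] L)) hv

end HasConvDeriv

end ConvDeriv

end CoalgConv

/-! ### Words, differential equations and power series in enveloping algebras -/

namespace EnvelopingLift

open CoalgConv WithConv


variable {K V V' W : Type*} [LieRing K] [LieAlgebra ℂ K] [AddCommGroup V] [Module ℂ V]
  [AddCommGroup V'] [Module ℂ V'] [AddCommGroup W] [Module ℂ W]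

theorem word_nil : word ([] : List K) = 1 := rfl

theorem word_append_singleton (l : List K) (g : K) : word (l ++ [g]) = word l * incl K g := by
  simp [word]

theorem linearMap_ext_word {u v : U K →ₗ[ℂ] W} (h : ∀ l, u (word l) = v (word l)) : u = v :=
  LinearMap.ext_on_range span_word h

/-- Linear maps on `U K` which agree at `1` and satisfy the same recursion under right
multiplication by elements of `K` are equal. -/
theorem linearMap_ext_right {u v : U K →ₗ[ℂ] W} (h1 : u 1 = v 1)
    (h : ∀ (x : U K) (g : K), u x = v x → u (x * incl K g) = v (x * incl K g)) : u = v := by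
  refine linearMap_ext_word fun l => ?_
  induction l using List.reverseRecOn with
  | nil => exact h1
  | append_singleton l g ih => rw [word_append_singleton]; exact h _ _ ih

/-- The convolution `∑ G(x⁽¹⁾)(u(x⁽²⁾))` at a word only involves pairs of words whose lengths add
up to its length. -/
theorem app_word_eq_zero (G : U K →ₗ[ℂ] V →ₗ[ℂ] W) (u : U K →ₗ[ℂ] V) (l : List K)
    (h : ∀ l₁ l₂ : List K, l₁.length + l₂.length = l.length → G (word l₁) (u (word l₂)) = 0) :
    app G u (word l) = 0 := by
  rw [app_apply]
  have hw := comul_word l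
  generalize comul (R := ℂ) (word l) = w at hw
  induction hw using Submodule.span_induction with
  | mem z hz =>
    obtain ⟨l₁, l₂, h12, rfl⟩ := hz
    simpa using h l₁ l₂ h12
  | zero => simp
  | add a b _ _ ha hb => rw [map_add, ha, hb, add_zero]
  | smul c a _ ha => rw [map_smul, ha, smul_zero]

section ODE

variable {B : W →ₗ[ℂ] V →ₗ[ℂ] W} {q : U K →ₗ[ℂ] V} {R : U K →ₗ[ℂ] W} {Y : ℂ → U K →ₗ[ℂ] W}

/-- Since `q` vanishes at `1`, the derivative `R + Y ⋆ q` of `Y` at a word involves only `R` and the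
values of `Y` at shorter words. -/
theorem ode_step (hq : q 1 = 0) (hY : HasConvDeriv Y fun t => R + app (B ∘ₗ Y t) q) (h0 : Y 0 = 0)
    (l : List K) (hl : ∀ l' : List K, l'.length < l.length → ∀ t, Y t (word l') = 0) (t : ℂ) :
    Y t (word l) = t • R (word l) := by
  have h := hY (word l)
  have e : ∀ t, (R + app (B ∘ₗ Y t) q) (word l) = R (word l) := by
    intro t
    rw [LinearMap.add_apply, app_word_eq_zero, add_zero]
    intro l₁ l₂ h12
    rcases l₂ with _ | ⟨g, l₂⟩
    · rw [word_nil, hq, map_zero]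
    · rw [LinearMap.comp_apply, hl l₁ (by simp at h12; omega), map_zero, LinearMap.zero_apply]
  simp only [e] at h
  rw [h.eq_of_const t, h0, LinearMap.zero_apply, zero_add]

/-- The only solution of `Y' = Y ⋆ q`, `Y₀ = 0` is `0`. -/
theorem ode_unique (hq : q 1 = 0) (hY : HasConvDeriv Y fun t => app (B ∘ₗ Y t) q) (h0 : Y 0 = 0)
    (t : ℂ) : Y t = 0 := by
  refine linearMap_ext_word fun l => ?_
  induction hn : l.length using Nat.strong_induction_on generalizing l t with
  | _ n ih =>
    have := ode_step (R := 0) (B := B) hq (by simpa using hY) h0 l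
      (fun l' hl' t => ih _ (hn ▸ hl') t l' rfl) t
    simpa using this

/-- If a solution of `Y' = R + Y ⋆ q` with constant `R` vanishes at `t = 0` and `t = 1`, then
`R = 0`. -/
theorem ode_source_eq_zero (hq : q 1 = 0) (hY : HasConvDeriv Y fun t => R + app (B ∘ₗ Y t) q)
    (h0 : Y 0 = 0) (h1 : Y 1 = 0) : R = 0 := by
  have main : ∀ (n : ℕ) (l : List K), l.length = n → R (word l) = 0 ∧ ∀ t, Y t (word l) = 0 := by
    intro n
    induction n using Nat.strong_induction_on with
    | _ n ih =>
      intro l hn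
      have h := ode_step hq hY h0 l (fun l' hl' => (ih _ (hn ▸ hl') l' rfl).2)
      have hR : R (word l) = 0 := by
        have := h 1
        rw [h1, one_smul] at this
        exact this.symm
      exact ⟨hR, fun t => by rw [h, hR, smul_zero]⟩
  exact linearMap_ext_word fun l => (main _ l rfl).1

end ODE

section Series

variable {𝒜 : Type*} [Ring 𝒜] [Algebra ℂ 𝒜]

theorem convMul_eq_app (u v : WithConv (U K →ₗ[ℂ] 𝒜)) :
    (u * v).ofConv = app (LinearMap.mul ℂ 𝒜 ∘ₗ u.ofConv) v.ofConv := by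
  ext x
  rw [app_repr]
  exact (ℛ ℂ x).convMul_apply u v

/-- The convolution power `u^{⋆n}` vanishes on words shorter than `n`, as each factor needs at least
one letter. -/
theorem pow_word_eq_zero {u : WithConv (U K →ₗ[ℂ] 𝒜)} (hu : u.ofConv 1 = 0) {n : ℕ} {l : List K}
    (h : l.length < n) : (u ^ n).ofConv (word l) = 0 := by
  induction n generalizing l with
  | zero => omega
  | succ n ih =>
    rw [pow_succ, convMul_eq_app]
    refine app_word_eq_zero _ _ _ fun l₁ l₂ h12 => ?_
    rcases l₂ with _ | ⟨g, l₂⟩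
    · rw [word_nil, hu, map_zero]
    · rw [LinearMap.comp_apply, ih (by simp at h12; omega), map_zero, LinearMap.zero_apply]

theorem exists_pow_eq_zero {u : WithConv (U K →ₗ[ℂ] 𝒜)} (hu : u.ofConv 1 = 0) (x : U K) :
    ∃ N, ∀ n, N ≤ n → (u ^ n).ofConv x = 0 := by
  have hx : x ∈ Submodule.span ℂ (Set.range (word : List K → U K)) := by rw [span_word]; trivial
  induction hx using Submodule.span_induction with
  | mem z hz =>
    obtain ⟨l, rfl⟩ := hz
    exact ⟨l.length + 1, fun n hn => pow_word_eq_zero hu (by omega)⟩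
  | zero => exact ⟨0, fun n _ => map_zero _⟩
  | add a b _ _ ha hb =>
    obtain ⟨N, hN⟩ := ha
    obtain ⟨M, hM⟩ := hb
    exact ⟨max N M, fun n hn => by
      rw [map_add, hN n (le_trans (le_max_left _ _) hn), hM n (le_trans (le_max_right _ _) hn),
        add_zero]⟩
  | smul c a _ ha =>
    obtain ⟨N, hN⟩ := ha
    exact ⟨N, fun n hn => by rw [map_smul, hN n hn, smul_zero]⟩

theorem series_support_finite {u : WithConv (U K →ₗ[ℂ] 𝒜)} (hu : u.ofConv 1 = 0)
    (c : PowerSeries ℂ) (x : U K) :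
    (Function.support fun n => c.coeff n • (u ^ n).ofConv x).Finite := by
  obtain ⟨N, hN⟩ := exists_pow_eq_zero hu x
  refine (Set.finite_lt_nat N).subset fun n hn => ?_
  by_contra h
  exact hn (by simp [hN n (by simpa using h)])

/-- The value `c(u) = ∑ cₙ u^{⋆n}` of a power series at a map `u` with `u 1 = 0`. At each point only
finitely many terms are nonzero. -/
def evalConv (u : WithConv (U K →ₗ[ℂ] 𝒜)) (hu : u.ofConv 1 = 0) (c : PowerSeries ℂ) :
    WithConv (U K →ₗ[ℂ] 𝒜) :=
  toConv
    { toFun := fun x => ∑ᶠ n, c.coeff n • (u ^ n).ofConv x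
      map_add' := fun x y => by
        rw [← finsum_add_distrib (series_support_finite hu c x) (series_support_finite hu c y)]
        simp
      map_smul' := fun a x => by
        rw [RingHom.id_apply, smul_finsum' _ (series_support_finite hu c x)]
        simp [smul_comm a] }

variable {u : WithConv (U K →ₗ[ℂ] 𝒜)} (hu : u.ofConv 1 = 0)

theorem evalConv_apply (c : PowerSeries ℂ) {x : U K} {N : ℕ}
    (hN : ∀ n, N ≤ n → (u ^ n).ofConv x = 0) :
    (evalConv u hu c).ofConv x = ∑ n ∈ Finset.range N, c.coeff n • (u ^ n).ofConv x := by
  change ∑ᶠ n, _ = _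
  refine finsum_eq_sum_of_support_subset _ fun n hn => ?_
  by_contra h
  exact hn (by simp [hN n (by simpa using h)])

theorem evalConv_word (c : PowerSeries ℂ) {l : List K} {N : ℕ} (hN : l.length < N) :
    (evalConv u hu c).ofConv (word l) =
      ∑ n ∈ Finset.range N, c.coeff n • (u ^ n).ofConv (word l) :=
  evalConv_apply hu c fun _ hn => pow_word_eq_zero hu (by omega)

/-- At words of length less than `N` a power series may be replaced by its truncation. -/
theorem evalConv_word_trunc (c : PowerSeries ℂ) {l : List K} {N : ℕ} (hN : l.length < N) :
    (evalConv u hu c).ofConv (word l) =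
      (Polynomial.aeval u (c.trunc N)).ofConv (word l) := by
  rw [evalConv_word hu c hN, Polynomial.aeval_def, PowerSeries.eval₂_trunc_eq_sum_range]
  simp [Algebra.algebraMap_eq_smul_one]

theorem aeval_word_trunc (hu : u.ofConv 1 = 0) (p : Polynomial ℂ) {l : List K} {N : ℕ}
    (hN : l.length < N) :
    (Polynomial.aeval u p).ofConv (word l) =
      (Polynomial.aeval u ((p : PowerSeries ℂ).trunc N)).ofConv (word l) := by
  obtain ⟨M, hM, hNM⟩ : ∃ M, p.natDegree < M ∧ N ≤ M :=
    ⟨max (p.natDegree + 1) N, by simp, le_max_right _ _⟩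
  have e : (p : PowerSeries ℂ).trunc M = p := PowerSeries.trunc_coe_eq_self hM
  conv_lhs => rw [← e]
  rw [← evalConv_word_trunc hu _ hN, ← evalConv_word_trunc hu _ (lt_of_lt_of_le hN hNM)]

/-- At a word of length `n` both sides only depend on the truncations of `c` and `d` after order `n`,
and polynomials may be evaluated in the convolution algebra. -/
theorem evalConv_mul (c d : PowerSeries ℂ) :
    evalConv u hu (c * d) = evalConv u hu c * evalConv u hu d := by
  refine WithConv.ext (linearMap_ext_word fun l => ?_)
  have h1 : (evalConv u hu c * evalConv u hu d).ofConv (word l) =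
      (Polynomial.aeval u (c.trunc (l.length + 1)) *
        Polynomial.aeval u (d.trunc (l.length + 1))).ofConv (word l) := by
    rw [convMul_eq_app, convMul_eq_app, app_apply, app_apply]
    have hw := comul_word l
    generalize comul (R := ℂ) (word l) = w at hw
    induction hw using Submodule.span_induction with
    | mem z hz =>
      obtain ⟨l₁, l₂, h12, rfl⟩ := hz
      simp only [TensorProduct.lift.tmul, LinearMap.compl₂_apply, LinearMap.comp_apply]
      rw [evalConv_word_trunc hu c (N := l.length + 1) (by omega),
        evalConv_word_trunc hu d (N := l.length + 1) (by omega)]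
    | zero => simp only [map_zero]
    | add a b _ _ ha hb => simp only [map_add, ha, hb]
    | smul c a _ ha => simp only [map_smul, ha]
  rw [h1, ← map_mul, aeval_word_trunc hu _ (Nat.lt_succ_self _), Polynomial.coe_mul,
    PowerSeries.trunc_trunc_mul_trunc, evalConv_word_trunc hu _ (Nat.lt_succ_self _)]

theorem evalConv_add (c d : PowerSeries ℂ) :
    evalConv u hu (c + d) = evalConv u hu c + evalConv u hu d := by
  refine WithConv.ext (LinearMap.ext fun x => ?_)
  obtain ⟨N, hN⟩ := exists_pow_eq_zero hu x
  rw [ofConv_add, LinearMap.add_apply, evalConv_apply hu _ hN, evalConv_apply hu _ hN,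
    evalConv_apply hu _ hN, ← Finset.sum_add_distrib]
  simp only [map_add, add_smul]

theorem evalConv_smul (a : ℂ) (c : PowerSeries ℂ) :
    evalConv u hu (a • c) = a • evalConv u hu c := by
  refine WithConv.ext (LinearMap.ext fun x => ?_)
  obtain ⟨N, hN⟩ := exists_pow_eq_zero hu x
  rw [ofConv_smul, LinearMap.smul_apply, evalConv_apply hu _ hN, evalConv_apply hu _ hN,
    Finset.smul_sum]
  simp [smul_smul]

theorem evalConv_X_pow (k : ℕ) : evalConv u hu (PowerSeries.X ^ k) = u ^ k := by
  refine WithConv.ext (linearMap_ext_word fun l => ?_)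
  rw [evalConv_word hu _ (N := l.length + k + 1) (by omega), Finset.sum_eq_single k]
  · simp [PowerSeries.coeff_X_pow]
  · intro n _ hn
    simp [PowerSeries.coeff_X_pow, hn]
  · simp

variable (u) in
/-- The algebra map `c ↦ c(u)` from power series to the convolution algebra. -/
def evalConvHom : PowerSeries ℂ →ₐ[ℂ] WithConv (U K →ₗ[ℂ] 𝒜) :=
  AlgHom.ofLinearMap
    { toFun := evalConv u hu, map_add' := evalConv_add hu, map_smul' := evalConv_smul hu }
    (by simpa using evalConv_X_pow hu 0) (evalConv_mul hu)

theorem evalConvHom_X : evalConvHom u hu PowerSeries.X = u :=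
  (congrArg (evalConv u hu) (pow_one PowerSeries.X).symm).trans
    ((evalConv_X_pow hu 1).trans (pow_one u))

theorem evalConvHom_word (c : PowerSeries ℂ) {l : List K} {N : ℕ} (hN : l.length < N) :
    (evalConvHom u hu c).ofConv (word l) =
      ∑ n ∈ Finset.range N, c.coeff n • (u ^ n).ofConv (word l) := evalConv_word hu c hN

theorem evalConvHom_one_apply (c : PowerSeries ℂ) :
    (evalConvHom u hu c).ofConv 1 = algebraMap ℂ 𝒜 (c.coeff 0) := by
  have := evalConvHom_word hu c (l := []) (N := 1) (by simp)
  simpa [word_nil, Algebra.algebraMap_eq_smul_one] using this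

/-- Only the coefficients below `N` matter at words of length less than `N`. -/
theorem evalConvHom_word_congr {c d : PowerSeries ℂ} {l : List K}
    (h : ∀ n ≤ l.length, c.coeff n = d.coeff n) :
    (evalConvHom u hu c).ofConv (word l) = (evalConvHom u hu d).ofConv (word l) := by
  rw [evalConvHom_word hu c (Nat.lt_succ_self _), evalConvHom_word hu d (Nat.lt_succ_self _)]
  refine Finset.sum_congr rfl fun n hn => ?_
  rw [h n (by simpa [Nat.lt_succ_iff] using hn)]

/-- Coefficientwise derivatives of a family of power series give the derivative of its values. -/
theorem hasConvDeriv_evalConvHom {c c' : ℂ → PowerSeries ℂ}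
    (h : ∀ n, HasPolyDeriv (fun t => (c t).coeff n) (fun t => (c' t).coeff n)) :
    HasConvDeriv (fun t => (evalConvHom u hu (c t)).ofConv)
      (fun t => (evalConvHom u hu (c' t)).ofConv) := by
  intro x
  obtain ⟨N, hN⟩ := exists_pow_eq_zero hu x
  have e : ∀ c, (evalConvHom u hu c).ofConv x =
      ∑ n ∈ Finset.range N, c.coeff n • (u ^ n).ofConv x := fun c => evalConv_apply hu c hN
  simp only [e]
  exact HasPolyDeriv.sum _ fun n _ =>
    (h n).comp_linear (LinearMap.toSpanSingleton ℂ 𝒜 ((u ^ n).ofConv x))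

end Series

end EnvelopingLift

/-! ### Contractions and their curvature -/

namespace CoalgConv

section Curvature

variable {C L : Type*} [AddCommGroup C] [Module ℂ C] [Coalgebra ℂ C] [IsCocomm ℂ C]
  [LieRing L] [LieAlgebra ℂ L]

/-- The curvature `D_g A(h) - D_h A(g) - A([g, h]) + [A(g), A(h)]` of a form `A` on `L` whose values
are `L`-valued functions on `C`, where `g : L` acts on functions by composition with `D g`. -/
def curvature (D : L → C →ₗ[ℂ] C) (A : L → C →ₗ[ℂ] L) (g h : L) : C →ₗ[ℂ] L :=
  A h ∘ₗ D g - A g ∘ₗ D h - A ⁅g, h⁆ + br (A g) (A h)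

/-- If `A` evolves by the infinitesimal gauge transformation `A' = d q + [A, q]`, its curvature
evolves by `F' = R + [F, q]`, where `R` measures the failure of `D` to be an action on `q`. -/
theorem hasConvDeriv_curvature {D : L → C →ₗ[ℂ] C} {q : C →ₗ[ℂ] L} {A : ℂ → L → C →ₗ[ℂ] L}
    (hD : ∀ g, IsCoderivation (D g))
    (hA : ∀ g, HasConvDeriv (fun t => A t g) fun t => q ∘ₗ D g + br (A t g) q) (g h : L) :
    HasConvDeriv (fun t => curvature D (A t) g h) fun t =>
      (q ∘ₗ D h ∘ₗ D g - q ∘ₗ D g ∘ₗ D h - q ∘ₗ D ⁅g, h⁆) + br (curvature D (A t) g h) q := by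
  refine (((((hA h).comp_right (D g)).sub ((hA g).comp_right (D h))).sub (hA ⁅g, h⁆)).add
    ((hA g).conv_br (hA h))).congr fun t => ?_
  simp only [curvature, LinearMap.add_comp, (hD _).br_comp, map_add, map_sub, LinearMap.add_apply,
    LinearMap.sub_apply]
  rw [br_skew (q ∘ₗ D g) (A t h), br_br (A t g) (A t h) q, br_skew (br (A t g) q) (A t h)]
  simp only [LinearMap.comp_assoc]
  abel

end Curvature

section Coderivation

variable {C V : Type*} [AddCommGroup C] [Module ℂ C] [Coalgebra ℂ C] [IsCocomm ℂ C]
  [AddCommGroup V] [Module ℂ V]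

/-- On a cocommutative coalgebra the coderivations form a module over the functions, that is, over
the dual algebra. -/
theorem isCoderivation_app {ρ : C →ₗ[ℂ] V →ₗ[ℂ] C} (hρ : ∀ v, IsCoderivation (ρ.flip v))
    (a : C →ₗ[ℂ] V) : IsCoderivation (app ρ a) := by
  have hl : ∀ D : C →ₗ[ℂ] C, D.lTensor C ∘ₗ comul = app (TensorProduct.mk ℂ C C) D := by
    intro D; ext x
    rw [app_repr, LinearMap.comp_apply]
    conv_lhs => rw [← (ℛ ℂ x).eq]
    simp
  have hr : ∀ D : C →ₗ[ℂ] C, D.rTensor C ∘ₗ comul =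
      app (TensorProduct.mk ℂ C C ∘ₗ D) LinearMap.id := by
    intro D; ext x
    rw [app_repr, LinearMap.comp_apply]
    conv_lhs => rw [← (ℛ ℂ x).eq]
    simp
  have key : LinearMap.llcomp ℂ V C (C ⊗[ℂ] C) comul ∘ₗ ρ =
      app ((LinearMap.lflip : (V →ₗ[ℂ] C →ₗ[ℂ] C ⊗[ℂ] C) ≃ₗ[ℂ] _).toLinearMap ∘ₗ
        LinearMap.llcomp ℂ V C (C →ₗ[ℂ] C ⊗[ℂ] C) (TensorProduct.mk ℂ C C) ∘ₗ ρ)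
          LinearMap.id +
      app (LinearMap.llcomp ℂ V C (C ⊗[ℂ] C) ∘ₗ TensorProduct.mk ℂ C C) ρ := by
    ext x v
    have h := hρ v x
    rw [LinearMap.flip_apply] at h
    rw [LinearMap.comp_apply, LinearMap.llcomp_apply, h,
      LinearMap.add_apply, LinearMap.add_apply, app_repr, app_repr]
    conv_lhs => rw [← (ℛ ℂ x).eq]
    simp
  have h : comul ∘ₗ app ρ a =
      (app ρ a).rTensor C ∘ₗ comul + (app ρ a).lTensor C ∘ₗ comul := by
    rw [hl, hr, comp_app, comp_app, key, map_add, LinearMap.add_apply, app_app]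
    congr 1
    rw [app_swap]
    rfl
  exact LinearMap.congr_fun h

end Coderivation

end CoalgConv

namespace EnvelopingLift

open CoalgConv WithConv


/-- The algebraic form of a contraction of a formal group to a point, on its coalgebra of
distributions `U K`: the vector fields `D g` trivialise the tangent bundle, and `q dt + A t` is the
pullback of the Maurer-Cartan form along the contraction. The differential equation says that the
`dt` component of the curvature of this form vanishes; at `t = 0` the contraction is constant and at
`t = 1` it is the identity. It is not assumed that `D` is an action of `L`. -/
structure IsContraction {K L : Type*} [LieRing K] [LieAlgebra ℂ K] [LieRing L] [LieAlgebra ℂ L]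
    (D : L → U K →ₗ[ℂ] U K) (q : U K →ₗ[ℂ] L) (A : ℂ → L → U K →ₗ[ℂ] L) : Prop where
  isCoderivation : ∀ g, IsCoderivation (D g)
  counit_comp : ∀ g, counit (R := ℂ) ∘ₗ D g = 0
  q_one : q 1 = 0
  hasConvDeriv : ∀ g, HasConvDeriv (fun t => A t g) fun t => q ∘ₗ D g + br (A t g) q
  A_zero : ∀ g, A 0 g = 0
  A_one : ∀ g, A 1 g = const g

namespace IsContraction

variable {K L : Type*} [LieRing K] [LieAlgebra ℂ K] [LieRing L] [LieAlgebra ℂ L]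
  {D : L → U K →ₗ[ℂ] U K} {q : U K →ₗ[ℂ] L} {A : ℂ → L → U K →ₗ[ℂ] L}

theorem const_comp (H : IsContraction D q A) {W : Type*} [AddCommGroup W] [Module ℂ W] (w : W)
    (g : L) : (const w : U K →ₗ[ℂ] W) ∘ₗ D g = 0 := by
  rw [const, LinearMap.comp_assoc, H.counit_comp, LinearMap.comp_zero]

theorem curvature_zero (H : IsContraction D q A) (g h : L) : curvature D (A 0) g h = 0 := by
  simp [curvature, H.A_zero]

/-- The curvature vanishes at both ends of the contraction, hence the `D g` satisfy the bracket
relations when applied to `q`. -/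
theorem source_eq_zero (H : IsContraction D q A) (g h : L) :
    q ∘ₗ D h ∘ₗ D g - q ∘ₗ D g ∘ₗ D h - q ∘ₗ D ⁅g, h⁆ = 0 := by
  have h' := hasConvDeriv_curvature H.isCoderivation H.hasConvDeriv g h
  simp only [br_def _ q] at h'
  refine ode_source_eq_zero (Y := fun t => curvature D (A t) g h) H.q_one h'
    (H.curvature_zero g h) ?_
  simp [curvature, H.A_one, H.const_comp, br_const]

/-- The pullback of the Maurer-Cartan form is flat. -/
theorem curvature_eq_zero (H : IsContraction D q A) (g h : L) (t : ℂ) :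
    curvature D (A t) g h = 0 := by
  have h' := hasConvDeriv_curvature H.isCoderivation H.hasConvDeriv g h
  simp only [H.source_eq_zero, zero_add, br_def _ q] at h'
  exact ode_unique (Y := fun t => curvature D (A t) g h) H.q_one h' (H.curvature_zero g h) t

/-- At the point `1` the equation for `A` reads `A_t(g)(1)' = q(D_g 1)`, and `A₁(g)(1) = g`. -/
theorem q_apply_one (H : IsContraction D q A) (g : L) : q (D g 1) = g := by
  have h := H.hasConvDeriv g 1
  have e : ∀ t, (q ∘ₗ D g + br (A t g) q) 1 = q (D g 1) := by
    intro t
    rw [LinearMap.add_apply, br_def, app_apply, Bialgebra.comul_one,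
      Algebra.TensorProduct.one_def, TensorProduct.lift.tmul, LinearMap.compl₂_apply, H.q_one,
      map_zero, add_zero, LinearMap.comp_apply]
  simp only [e] at h
  have := h.eq_of_const 1
  simpa [H.A_one, H.A_zero, const_apply] using this.symm

end IsContraction

/-! ### The action of `L` on the symmetric coalgebra -/

/-- The underlying vector space of `L` with zero bracket. Its enveloping algebra is the symmetric
algebra of `L`. -/
def Ab (L : Type*) : Type _ := L

variable {L : Type*} [LieRing L] [LieAlgebra ℂ L]

instance : AddCommGroup (Ab L) := inferInstanceAs (AddCommGroup L)
instance : Module ℂ (Ab L) := inferInstanceAs (Module ℂ L)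
instance : LieRing (Ab L) where
  bracket _ _ := 0
  add_lie _ _ _ := (add_zero 0).symm
  lie_add _ _ _ := (add_zero 0).symm
  lie_self _ := rfl
  leibniz_lie _ _ _ := (add_zero 0).symm
instance : LieAlgebra ℂ (Ab L) where
  lie_smul c _ _ := (smul_zero c).symm

variable (L) in
/-- The identity map `L → Ab L`. -/
def toAb : L ≃ₗ[ℂ] Ab L := LinearEquiv.refl ℂ L

theorem ab_lie {L : Type*} [LieRing L] (x y : Ab L) : ⁅x, y⁆ = 0 := rfl

variable (L) in
/-- The product `x ↦ v ↦ x v` of the symmetric algebra with elements of degree one. -/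
def symMul : U (Ab L) →ₗ[ℂ] L →ₗ[ℂ] U (Ab L) :=
  (LinearMap.mul ℂ (U (Ab L))).compl₂ (incl (Ab L) ∘ₗ (toAb L).toLinearMap)

theorem symMul_apply (x : U (Ab L)) (v : L) : symMul L x v = x * incl (Ab L) (toAb L v) := rfl

theorem symMul_symMul (x : U (Ab L)) (v w : L) :
    symMul L (symMul L x v) w = symMul L (symMul L x w) v := by
  simp only [symMul_apply, mul_assoc]
  congr 1
  rw [← sub_eq_zero, ← incl_lie, ab_lie, map_zero]

section

attribute [local instance 100] LieRing.ofAssociativeRing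

variable (L) in
/-- The action of the symmetric algebra on its quotient `ℂ ⊕ L` by the square of the augmentation
ideal. -/
def symToEnd : U (Ab L) →ₐ[ℂ] Module.End ℂ (ℂ × L) :=
  UniversalEnvelopingAlgebra.lift ℂ
    { toFun := fun v => LinearMap.inr ℂ ℂ L ∘ₗ
        LinearMap.toSpanSingleton ℂ L ((toAb L).symm v) ∘ₗ LinearMap.fst ℂ ℂ L
      map_add' := fun v w => by ext <;> simp
      map_smul' := fun c v => by ext <;> simp
      map_lie' := fun {v w} => by
        rw [LieRing.of_associative_ring_bracket, ab_lie]
        ext <;> simp }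

theorem symToEnd_incl (v : L) (z : ℂ × L) :
    symToEnd L (incl (Ab L) (toAb L v)) z = (0, z.1 • v) := by
  rw [symToEnd, incl]
  erw [UniversalEnvelopingAlgebra.lift_ι_apply]
  simp

end

theorem symToEnd_inr (x : U (Ab L)) (v : L) :
    symToEnd L x (0, v) = (0, counit (R := ℂ) x • v) := by
  let F : U (Ab L) →ₗ[ℂ] ℂ × L := LinearMap.applyₗ (0, v) ∘ₗ (symToEnd L).toLinearMap
  have : F = const (0, v) := by
    refine linearMap_ext_right ?_ fun x g _ => ?_
    · simp [F, const_apply]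
    · have h := symToEnd_incl ((toAb L).symm g) ((0, v) : ℂ × L)
      rw [LinearEquiv.apply_symm_apply, zero_smul] at h
      simp only [F, LinearMap.comp_apply, AlgHom.toLinearMap_apply, map_mul,
        LinearMap.applyₗ_apply_apply, Module.End.mul_apply, h]
      rw [const_apply, counit_eq, map_mul, augmentation_incl, mul_zero, zero_smul]
      exact map_zero _
  have := LinearMap.congr_fun this x
  simpa [F, const_apply] using this

variable (L) in
/-- The projection of the symmetric algebra of `L` to its degree one part. -/
def symProj : U (Ab L) →ₗ[ℂ] L :=
  LinearMap.snd ℂ ℂ L ∘ₗ LinearMap.applyₗ (1, 0) ∘ₗ (symToEnd L).toLinearMap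

theorem symProj_one : symProj L 1 = 0 := by simp [symProj]

theorem symProj_symMul (x : U (Ab L)) (v : L) :
    symProj L (symMul L x v) = counit (R := ℂ) x • v := by
  have h := symToEnd_incl v ((1, 0) : ℂ × L)
  rw [one_smul] at h
  simp only [symProj, symMul_apply, LinearMap.comp_apply, AlgHom.toLinearMap_apply, map_mul,
    LinearMap.applyₗ_apply_apply, Module.End.mul_apply, h, symToEnd_inr]
  rfl

/-- The coderivation `∑ x⁽¹⁾ a(x⁽²⁾)` is determined by its projection `a` to degree one. -/
theorem symProj_comp_app (a : U (Ab L) →ₗ[ℂ] L) : symProj L ∘ₗ app (symMul L) a = a := by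
  have : LinearMap.llcomp ℂ L (U (Ab L)) L (symProj L) ∘ₗ symMul L = const LinearMap.id := by
    ext x v
    exact symProj_symMul x v
  rw [comp_app, this, app_const_left, LinearMap.id_comp]

theorem counit_mul_incl {K : Type*} [LieRing K] [LieAlgebra ℂ K] (x : U K) (g : K) :
    counit (R := ℂ) (x * incl K g) = 0 := by
  rw [counit_eq, map_mul, augmentation_incl, mul_zero]

/-- The elements of `K` are primitive, so right multiplication by them is a coderivation. -/
theorem isCoderivation_mulRight {K : Type*} [LieRing K] [LieAlgebra ℂ K] (g : K) :
    IsCoderivation (LinearMap.mulRight ℂ (incl K g)) := by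
  intro x
  rw [LinearMap.mulRight_apply, comul_eq, map_mul, coproduct_incl, mul_add, comul_eq]
  generalize coproduct K x = z
  induction z using TensorProduct.induction_on with
  | zero => simp
  | add a b ha hb => simp only [map_add, add_mul, add_add_add_comm, ← ha, ← hb]
  | tmul a b => simp

theorem isCoderivation_app_symMul (a : U (Ab L) →ₗ[ℂ] L) :
    IsCoderivation (app (symMul L) a) :=
  isCoderivation_app (ρ := symMul L) (fun v => isCoderivation_mulRight (toAb L v)) a

theorem counit_comp_app_symMul (a : U (Ab L) →ₗ[ℂ] L) :
    counit (R := ℂ) ∘ₗ app (symMul L) a = 0 := by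
  have : LinearMap.llcomp ℂ L (U (Ab L)) ℂ counit ∘ₗ symMul L = 0 := by
    ext x v
    exact counit_mul_incl x (toAb L v)
  rw [comp_app, this, map_zero, LinearMap.zero_apply]

end EnvelopingLift

namespace EnvelopingLift

open CoalgConv WithConv


variable {L : Type*} [LieRing L] [LieAlgebra ℂ L]

/-- The power series `(1 - exp (-t X)) / X`, the solution of `K' = 1 - X K`, `K₀ = 0`. -/
def expSeries (t : ℂ) : PowerSeries ℂ :=
  PowerSeries.mk fun n => (-1) ^ n * t ^ (n + 1) / ((n + 1).factorial : ℂ)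

theorem expSeries_zero : expSeries 0 = 0 := by
  ext n; simp [expSeries]

theorem hasPolyDeriv_coeff_expSeries (n : ℕ) :
    HasPolyDeriv (fun t => (expSeries t).coeff n)
      (fun t => (1 - PowerSeries.X * expSeries t).coeff n) := by
  have h := HasPolyDeriv.monomial (n + 1) ((-1) ^ n / ((n + 1).factorial : ℂ))
  convert h using 1
  · funext t
    simp only [expSeries, PowerSeries.coeff_mk, smul_eq_mul]
    ring
  · funext t
    have hn : ((n : ℂ) + 1) ≠ 0 := Nat.cast_add_one_ne_zero n
    rcases n with _ | n
    · simp
    · have hf : (((n + 1).factorial : ℕ) : ℂ) ≠ 0 := Nat.cast_ne_zero.mpr (Nat.factorial_ne_zero _)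
      simp only [map_sub, PowerSeries.coeff_one, PowerSeries.coeff_succ_X_mul, expSeries,
        PowerSeries.coeff_mk, smul_eq_mul, Nat.factorial_succ (n + 1), Nat.add_sub_cancel]
      push_cast at hn ⊢
      field_simp
      ring

theorem constantCoeff_expSeries_one : PowerSeries.constantCoeff (expSeries 1) ≠ 0 := by
  rw [← PowerSeries.coeff_zero_eq_constantCoeff_apply]
  simp [expSeries]

section EndSeries

variable {K : Type*} [LieRing K] [LieAlgebra ℂ K] {W : Type*} [AddCommGroup W] [Module ℂ W]

/-- The convolution algebra of maps to `End W` acts on maps to `W`. -/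
theorem app_convMul (P Q : WithConv (U K →ₗ[ℂ] Module.End ℂ W)) (v : U K →ₗ[ℂ] W) :
    app (P * Q).ofConv v = app P.ofConv (app Q.ofConv v) := by
  rw [app_app, convMul_eq_app]
  rfl

theorem app_convOne (v : U K →ₗ[ℂ] W) :
    app (1 : WithConv (U K →ₗ[ℂ] Module.End ℂ W)).ofConv v = v := by
  have : (1 : WithConv (U K →ₗ[ℂ] Module.End ℂ W)).ofConv = const LinearMap.id := by
    ext x y
    simp [const_apply, LinearMap.convOne_def, Algebra.algebraMap_eq_smul_one]
  rw [this, app_const_left, LinearMap.id_comp]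

end EndSeries

variable (L) in
/-- The map `x ↦ ad (p x)` on the symmetric coalgebra, as an element of its convolution algebra. -/
def symAd : WithConv (U (Ab L) →ₗ[ℂ] Module.End ℂ L) :=
  toConv ((LieModule.toEnd ℂ L L : L →ₗ[ℂ] Module.End ℂ L) ∘ₗ symProj L)

theorem symAd_one : (symAd L).ofConv 1 = 0 := by
  simp [symAd, symProj_one]

theorem app_symAd (v : U (Ab L) →ₗ[ℂ] L) : app (symAd L).ofConv v = br (symProj L) v := rfl

/-- The function `ψ(ad p) g` with `ψ = X / (1 - exp (-X))`: the coefficient of the vector field by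
which `g` acts on the symmetric coalgebra. -/
def symField (g : L) : U (Ab L) →ₗ[ℂ] L :=
  app (evalConvHom (symAd L) symAd_one (expSeries 1)⁻¹).ofConv (const g)

/-- The function `(1 - exp (-t ad p)) / (ad p)` applied to `symField g`: the Maurer-Cartan form of
the contraction `exp (t p)`, evaluated on the vector field of `g`. -/
def symForm (t : ℂ) (g : L) : U (Ab L) →ₗ[ℂ] L :=
  app (evalConvHom (symAd L) symAd_one (expSeries t)).ofConv (symField g)

/-- The vector field by which `g` acts on the symmetric coalgebra. -/
def symAct (g : L) : U (Ab L) →ₗ[ℂ] U (Ab L) := app (symMul L) (symField g)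

theorem symField_add (g h : L) : symField (g + h) = symField g + symField h := by
  rw [symField, const_add, map_add]; rfl

theorem symField_smul (c : ℂ) (g : L) : symField (c • g) = c • symField g := by
  rw [symField, const_smul, map_smul]; rfl

theorem symProj_comp_symAct (g : L) : symProj L ∘ₗ symAct g = symField g := symProj_comp_app _

theorem isContraction_sym : IsContraction symAct (symProj L) symForm where
  isCoderivation _ := isCoderivation_app_symMul _
  counit_comp _ := counit_comp_app_symMul _
  q_one := symProj_one
  hasConvDeriv g := by
    have h := (hasConvDeriv_evalConvHom (u := symAd L) symAd_one
      hasPolyDeriv_coeff_expSeries).conv_app (HasConvDeriv.const (symField g))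
    refine h.congr fun t => ?_
    rw [symProj_comp_symAct, map_zero, add_zero, map_sub, map_one, map_mul, evalConvHom_X,
      ofConv_sub, map_sub, LinearMap.sub_apply, app_convOne, app_convMul, app_symAd,
      br_skew (symProj L), sub_neg_eq_add]
    rfl
  A_zero g := by rw [symForm, expSeries_zero, map_zero, ofConv_zero, map_zero, LinearMap.zero_apply]
  A_one g := by
    rw [symForm, symField, ← app_convMul, ← map_mul,
      PowerSeries.mul_inv_cancel _ constantCoeff_expSeries_one, map_one, app_convOne]

/-- The vector fields `symAct g` commute up to the bracket of `L`: both sides are of the form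
`∑ x⁽¹⁾ a(x⁽²⁾)`, so that they may be compared after projecting to `L`. -/
theorem symAct_lie (g h : L) :
    symAct ⁅g, h⁆ = symAct h ∘ₗ symAct g - symAct g ∘ₗ symAct h := by
  let M : U (Ab L) →ₗ[ℂ] L →ₗ[ℂ] L →ₗ[ℂ] U (Ab L) :=
    LinearMap.llcomp ℂ L (U (Ab L)) (L →ₗ[ℂ] U (Ab L)) (symMul L) ∘ₗ symMul L
  have hM : (LinearMap.lflip : (L →ₗ[ℂ] L →ₗ[ℂ] U (Ab L)) ≃ₗ[ℂ] _).toLinearMap ∘ₗ M = M := by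
    ext x v w
    exact symMul_symMul x w v
  have e : ∀ g h : L, symAct h ∘ₗ symAct g =
      app (app M (symField g)) (symField h) + app (symMul L) (symField h ∘ₗ symAct g) := by
    intro g h
    have h1 := (isContraction_sym.isCoderivation g).app_comp (symMul L) (symField h)
    rw [show symMul L ∘ₗ symAct g = app M (symField g) from comp_app _ _ _] at h1
    exact h1
  have hR := isContraction_sym.source_eq_zero g h
  simp only [← LinearMap.comp_assoc, symProj_comp_symAct] at hR
  rw [e, e, app_swap, hM, add_sub_add_left_eq_sub, ← map_sub, sub_eq_zero.mp hR]
  rfl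

/-! ### The contraction of the enveloping algebra -/

section

attribute [local instance 100] LieRing.ofAssociativeRing

variable (L) in
/-- The right action of `U L` on the symmetric coalgebra that extends `symAct`. -/
def symActHom : U L →ₐ[ℂ] (Module.End ℂ (U (Ab L)))ᵐᵒᵖ :=
  UniversalEnvelopingAlgebra.lift ℂ
    { toFun := fun g => MulOpposite.op (symAct g)
      map_add' := fun g h => by rw [symAct, symField_add, map_add]; rfl
      map_smul' := fun c g => by rw [symAct, symField_smul, map_smul]; rfl
      map_lie' := fun {g h} => by
        rw [LieRing.of_associative_ring_bracket, symAct_lie]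
        rfl }

theorem symActHom_incl (g : L) : symActHom L (incl L g) = MulOpposite.op (symAct g) :=
  UniversalEnvelopingAlgebra.lift_ι_apply ℂ _ g

end

variable (L) in
/-- The map `x ↦ 1 · x` from `U L` to the symmetric coalgebra. -/
def toSym : U L →ₗ[ℂ] U (Ab L) :=
  LinearMap.applyₗ 1 ∘ₗ (MulOpposite.opLinearEquiv ℂ).symm.toLinearMap ∘ₗ (symActHom L).toLinearMap

theorem toSym_one : toSym L 1 = 1 := by simp [toSym]

theorem toSym_mul_incl (x : U L) (g : L) : toSym L (x * incl L g) = symAct g (toSym L x) := by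
  simp [toSym, symActHom_incl]

theorem comul_toSym (x : U L) :
    comul (R := ℂ) (toSym L x) = TensorProduct.map (toSym L) (toSym L) (comul x) := by
  have h : comul ∘ₗ toSym L = TensorProduct.map (toSym L) (toSym L) ∘ₗ comul := by
    refine linearMap_ext_right ?_ fun x g ih => ?_
    · simp [toSym_one, Algebra.TensorProduct.one_def]
    · simp only [LinearMap.comp_apply] at ih ⊢
      have h2 := isCoderivation_mulRight g x
      rw [LinearMap.mulRight_apply] at h2
      rw [toSym_mul_incl, isContraction_sym.isCoderivation, ih, h2]
      generalize comul (R := ℂ) x = z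
      induction z using TensorProduct.induction_on with
      | zero => simp
      | add a b ha hb =>
        simp only [map_add] at ha hb ⊢
        rw [add_add_add_comm, ha, hb]
        abel
      | tmul a b => simp [toSym_mul_incl]
  exact LinearMap.congr_fun h x

theorem counit_comp_toSym : counit (R := ℂ) ∘ₗ toSym L = counit := by
  refine linearMap_ext_right ?_ fun x g _ => ?_
  · simp [toSym_one]
  · rw [LinearMap.comp_apply, toSym_mul_incl, counit_mul_incl]
    exact LinearMap.congr_fun (isContraction_sym.counit_comp g) _

theorem app_comp_toSym {V W : Type*} [AddCommGroup V] [Module ℂ V] [AddCommGroup W] [Module ℂ W]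
    (G : U (Ab L) →ₗ[ℂ] V →ₗ[ℂ] W) (u : U (Ab L) →ₗ[ℂ] V) :
    app G u ∘ₗ toSym L = app (G ∘ₗ toSym L) (u ∘ₗ toSym L) := by
  ext x
  rw [LinearMap.comp_apply, app_apply, app_apply, comul_toSym, ← LinearMap.comp_apply,
    TensorProduct.lift_comp_map]
  rfl

variable (L) in
/-- The logarithm as a map `U L → L`: the degree one part of `x ↦ 1 · x`. -/
def logProj : U L →ₗ[ℂ] L := symProj L ∘ₗ toSym L

/-- The pullback of `symForm` to `U L`. -/
def logForm (t : ℂ) (g : L) : U L →ₗ[ℂ] L := symForm t g ∘ₗ toSym L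

theorem isContraction_log :
    IsContraction (fun g : L => LinearMap.mulRight ℂ (incl L g)) (logProj L) logForm where
  isCoderivation := isCoderivation_mulRight
  counit_comp g := by
    ext x
    exact counit_mul_incl x g
  q_one := by rw [logProj, LinearMap.comp_apply, toSym_one, symProj_one]
  hasConvDeriv g := by
    have h : HasConvDeriv (fun t => logForm t g) fun t =>
        (symProj L ∘ₗ symAct g + br (symForm t g) (symProj L)) ∘ₗ toSym L :=
      fun x => isContraction_sym.hasConvDeriv g (toSym L x)
    refine h.congr fun t => ?_
    have e : symAct g ∘ₗ toSym L = toSym L ∘ₗ LinearMap.mulRight ℂ (incl L g) := by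
      ext x
      exact (toSym_mul_incl x g).symm
    rw [LinearMap.add_comp, LinearMap.comp_assoc, e, br_def, app_comp_toSym]
    rfl
  A_zero g := by rw [logForm, isContraction_sym.A_zero, LinearMap.zero_comp]
  A_one g := by
    rw [logForm, isContraction_sym.A_one, const, LinearMap.comp_assoc, counit_comp_toSym]
    rfl

theorem logProj_incl (g : L) : logProj L (incl L g) = g := by
  simpa using isContraction_log.q_apply_one g

theorem incl_injective : Function.Injective (incl L) :=
  Function.LeftInverse.injective logProj_incl

end EnvelopingLift

/-! ### The logarithm and the exponential of the identity -/

namespace EnvelopingLift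

open CoalgConv WithConv

variable {L : Type*} [LieRing L] [LieAlgebra ℂ L]

/-- `log (exp X) = X` up to order `N`. Both sides have the same derivative up to order `N`, by the
geometric series in `1 - exp X`. -/
theorem coeff_log_exp (N k : ℕ) (hk : k ≤ N) :
    (∑ n ∈ Finset.range N, ((-1) ^ n / (n + 1) : ℂ) • (PowerSeries.exp ℂ - 1) ^ (n + 1)).coeff k =
      (PowerSeries.X : PowerSeries ℂ).coeff k := by
  set e := PowerSeries.exp ℂ with he
  have h0 : PowerSeries.constantCoeff (e - 1) = 0 := by simp [he]
  rcases k with _ | k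
  · simp [h0]
  have hd : PowerSeries.derivative ℂ
      (∑ n ∈ Finset.range N, ((-1) ^ n / (n + 1) : ℂ) • (e - 1) ^ (n + 1)) =
      1 - (1 - e) ^ N := by
    rw [← geom_sum_mul_neg, map_sum, Finset.sum_mul, sub_sub_cancel]
    refine Finset.sum_congr rfl fun n _ => ?_
    have hn : ((n : ℂ) + 1) ≠ 0 := Nat.cast_add_one_ne_zero n
    rw [Derivation.map_smul, PowerSeries.derivative_pow, map_sub, he, PowerSeries.derivative_exp,
      Derivation.map_one_eq_zero, sub_zero, ← he, Nat.add_sub_cancel, mul_assoc]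
    have h1 : (((n + 1 : ℕ) : PowerSeries ℂ)) = PowerSeries.C ((n : ℂ) + 1) := by
      push_cast; simp
    have h2 : (1 - e) ^ n = PowerSeries.C ((-1 : ℂ) ^ n) * (e - 1) ^ n := by
      rw [← neg_sub e 1, neg_pow]; simp
    rw [h1, h2, PowerSeries.smul_eq_C_mul, ← mul_assoc, ← map_mul, div_mul_cancel₀ _ hn, mul_assoc]
  have hz : ((1 - e) ^ N).coeff k = 0 := by
    have hX : (PowerSeries.X : PowerSeries ℂ) ^ N ∣ (1 - e) ^ N := by
      refine pow_dvd_pow_of_dvd (PowerSeries.X_dvd_iff.mpr ?_) N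
      rw [← neg_sub, map_neg, h0, neg_zero]
    exact PowerSeries.X_pow_dvd_iff.mp hX k (by omega)
  have hX : PowerSeries.derivative ℂ (PowerSeries.X : PowerSeries ℂ) = 1 :=
    PowerSeries.derivative_X
  have hk1 : ((k : ℂ) + 1) ≠ 0 := Nat.cast_add_one_ne_zero k
  have e1 := congrArg (PowerSeries.coeff k) hd
  have e2 := congrArg (PowerSeries.coeff k) hX
  rw [map_sub, hz, sub_zero, ← e2, PowerSeries.coeff_derivative,
    PowerSeries.coeff_derivative] at e1
  exact mul_right_cancel₀ hk1 e1

theorem coeff_rescale_exp (t : ℂ) (n : ℕ) :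
    (PowerSeries.rescale t (PowerSeries.exp ℂ)).coeff n = t ^ n / (n.factorial : ℂ) := by
  rw [PowerSeries.coeff_rescale, PowerSeries.coeff_exp]
  simp [div_eq_mul_inv]

theorem hasPolyDeriv_coeff_exp (n : ℕ) :
    HasPolyDeriv (fun t => (PowerSeries.rescale t (PowerSeries.exp ℂ)).coeff n)
      (fun t => (PowerSeries.rescale t (PowerSeries.exp ℂ) * PowerSeries.X).coeff n) := by
  have h := HasPolyDeriv.monomial n (1 / (n.factorial : ℂ))
  convert h using 1
  · funext t
    rw [coeff_rescale_exp, smul_eq_mul]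
    ring
  · funext t
    rcases n with _ | n
    · simp
    · have hn : ((n : ℂ) + 1) ≠ 0 := Nat.cast_add_one_ne_zero n
      have hf : ((n.factorial : ℕ) : ℂ) ≠ 0 := Nat.cast_ne_zero.mpr (Nat.factorial_ne_zero _)
      rw [PowerSeries.coeff_succ_mul_X, coeff_rescale_exp, Nat.factorial_succ, smul_eq_mul,
        Nat.add_sub_cancel]
      push_cast
      field_simp

variable (L) in
/-- The map `logProj` with values in `U L`, in the convolution algebra. -/
def logConv : WithConv (U L →ₗ[ℂ] U L) := toConv (incl L ∘ₗ logProj L)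

theorem logConv_one : (logConv L).ofConv 1 = 0 := by
  change incl L (logProj L 1) = 0
  rw [isContraction_log.q_one, map_zero]

/-- The convolution exponential of `t` times the logarithm. -/
def expLog (t : ℂ) : WithConv (U L →ₗ[ℂ] U L) :=
  evalConvHom (logConv L) logConv_one (PowerSeries.rescale t (PowerSeries.exp ℂ))

theorem hasConvDeriv_expLog :
    HasConvDeriv (fun t => (expLog t : WithConv (U L →ₗ[ℂ] U L)).ofConv)
      fun t => (expLog t * logConv L).ofConv := by
  have h := hasConvDeriv_evalConvHom (u := logConv L) logConv_one hasPolyDeriv_coeff_exp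
  simp only [map_mul, evalConvHom_X] at h
  exact h

theorem expLog_zero : (expLog 0 : WithConv (U L →ₗ[ℂ] U L)) = 1 := by
  rw [expLog, PowerSeries.rescale_zero]
  simp

theorem expLog_neg_mul (t : ℂ) : (expLog (-t) * expLog t : WithConv (U L →ₗ[ℂ] U L)) = 1 := by
  rw [expLog, expLog, ← map_mul, PowerSeries.exp_mul_exp_eq_exp_add, neg_add_cancel,
    PowerSeries.rescale_zero]
  simp

theorem expLog_apply_one (t : ℂ) : (expLog t : WithConv (U L →ₗ[ℂ] U L)).ofConv 1 = 1 := by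
  rw [expLog, evalConvHom_one_apply, coeff_rescale_exp]
  simp

theorem ofConv_mul_comp {D : U L →ₗ[ℂ] U L} (hD : IsCoderivation D)
    (u v : WithConv (U L →ₗ[ℂ] U L)) :
    toConv ((u * v).ofConv ∘ₗ D) = toConv (u.ofConv ∘ₗ D) * v + u * toConv (v.ofConv ∘ₗ D) := by
  refine WithConv.ext ?_
  rw [ofConv_add, convMul_eq_app, convMul_eq_app, convMul_eq_app, ofConv_toConv, hD.app_comp]
  rfl

theorem incl_comp_br (u v : U L →ₗ[ℂ] L) :
    toConv (incl L ∘ₗ br u v) = toConv (incl L ∘ₗ u) * toConv (incl L ∘ₗ v) -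
      toConv (incl L ∘ₗ v) * toConv (incl L ∘ₗ u) := by
  refine WithConv.ext ?_
  rw [ofConv_sub, convMul_eq_app, convMul_eq_app]
  change incl L ∘ₗ br u v = app (LinearMap.mul ℂ (U L) ∘ₗ incl L ∘ₗ u) (incl L ∘ₗ v) -
    app (LinearMap.mul ℂ (U L) ∘ₗ incl L ∘ₗ v) (incl L ∘ₗ u)
  rw [app_comp_flip _ (incl L ∘ₗ v)]
  ext x
  simp [app_repr, br_repr, incl_lie]

/-- The contraction `expLog t` pulls the Maurer-Cartan form back to `logForm t`. -/
theorem expLog_comp_mulRight (t : ℂ) (g : L) :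
    toConv ((expLog t).ofConv ∘ₗ LinearMap.mulRight ℂ (incl L g)) =
      expLog t * toConv (incl L ∘ₗ logForm t g) := by
  let R : U L →ₗ[ℂ] U L := LinearMap.mulRight ℂ (incl L g)
  let a : ℂ → WithConv (U L →ₗ[ℂ] U L) := fun t => toConv (incl L ∘ₗ logForm t g)
  -- With `q = logProj`, the difference `Y` of the two sides satisfies `Y' = Y ⋆ q` and `Y₀ = 0`.
  let Y : ℂ → WithConv (U L →ₗ[ℂ] U L) := fun t => toConv ((expLog t).ofConv ∘ₗ R) - expLog t * a t
  have ha : HasConvDeriv (fun t => (a t).ofConv) fun t =>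
      (toConv ((logConv L).ofConv ∘ₗ R) + (a t * logConv L - logConv L * a t)).ofConv := by
    refine ((isContraction_log.hasConvDeriv g).comp_left (incl L)).congr fun t => ?_
    rw [LinearMap.comp_add]
    exact congrArg (fun z : WithConv (U L →ₗ[ℂ] U L) => incl L ∘ₗ logProj L ∘ₗ R + z.ofConv)
      (incl_comp_br (logForm t g) (logProj L))
  have hY : HasConvDeriv (fun t => (Y t).ofConv) fun t =>
      app (LinearMap.mul ℂ (U L) ∘ₗ (Y t).ofConv) (logConv L).ofConv := by
    have h1 := hasConvDeriv_expLog.comp_right R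
    have h2 := (hasConvDeriv_expLog.comp_left (LinearMap.mul ℂ (U L))).conv_app ha
    have h3 := h1.sub h2
    simp only [← convMul_eq_app] at h3 ⊢
    refine h3.congr fun t => ?_
    refine congrArg ofConv (a₁ := toConv ((expLog t * logConv L).ofConv ∘ₗ R) -
      (expLog t * logConv L * a t + expLog t * (toConv ((logConv L).ofConv ∘ₗ R) +
        (a t * logConv L - logConv L * a t)))) (a₂ := Y t * logConv L) ?_
    rw [ofConv_mul_comp (isCoderivation_mulRight g)]
    simp only [Y, mul_add, mul_sub, sub_mul, mul_assoc]
    abel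
  have h0 : (Y 0).ofConv = 0 := by
    ext x
    simp only [Y, a, isContraction_log.A_zero, LinearMap.comp_zero, toConv_zero, mul_zero, sub_zero,
      expLog_zero]
    exact (congrArg (algebraMap ℂ (U L)) (counit_mul_incl x g)).trans (map_zero _)
  have := ode_unique logConv_one hY h0 t
  exact sub_eq_zero.mp (WithConv.ext this)

/-- At `t = 1` the equation of `expLog_comp_mulRight` says that the exponential commutes with right
multiplication by elements of `L`. -/
theorem expLog_one : (expLog 1 : WithConv (U L →ₗ[ℂ] U L)).ofConv = LinearMap.id := by
  refine linearMap_ext_right (expLog_apply_one 1) fun x g ih => ?_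
  have h := congrArg (fun z : WithConv (U L →ₗ[ℂ] U L) => z.ofConv x) (expLog_comp_mulRight 1 g)
  rw [isContraction_log.A_one, comp_const] at h
  simp only [convMul_eq_app, app_const_right] at h
  exact h.trans (congrArg (· * incl L g) ih)

/-- The logarithm of the identity in the convolution algebra is `logProj`, because the exponential
of `logProj` is the identity. -/
theorem pr_eq : pr L = incl L ∘ₗ logProj L := by
  have haug : toConv (augProj L) =
      evalConvHom (logConv L) logConv_one (PowerSeries.exp ℂ - 1) := by
    have h1 : toConv (LinearMap.id : U L →ₗ[ℂ] U L) = expLog 1 := by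
      rw [← expLog_one, toConv_ofConv]
    rw [map_sub, map_one, augProj, toConv_sub, h1, expLog, PowerSeries.rescale_one]
    rfl
  refine linearMap_ext_word fun l => ?_
  have h1 : pr L (word l) = ∑ n ∈ Finset.range l.length,
      ((-1) ^ n / (n + 1) : ℂ) • convPow (augProj L) (n + 1) (word l) := by
    change ∑ᶠ n, _ = _
    refine finsum_eq_sum_of_support_subset _ fun n hn => ?_
    by_contra h
    refine hn ?_
    have h' : l.length ≤ n := by simpa using h
    simp only [convPow_word _ augProj_one (n + 1) l (by omega), smul_zero]
  have h2 : ∀ n, convPow (augProj L) n (word l) =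
      (evalConvHom (logConv L) logConv_one ((PowerSeries.exp ℂ - 1) ^ n)).ofConv (word l) := by
    intro n
    rw [convPow, haug, map_pow]
  have h3 := evalConvHom_word_congr (u := logConv L) logConv_one (l := l)
    (coeff_log_exp l.length)
  rw [evalConvHom_X] at h3
  refine Eq.trans ?_ h3
  rw [h1]
  simp only [h2, map_sum, map_smul, ofConv_sum, LinearMap.sum_apply, ofConv_smul,
    LinearMap.smul_apply]

theorem phi_eq (t : ℂ) : phi t = (expLog t : WithConv (U L →ₗ[ℂ] U L)).ofConv := by
  have h : toConv (pr L) = logConv L := by rw [pr_eq]; rfl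
  ext x
  change ∑ᶠ n, _ = ∑ᶠ n, _
  refine finsum_congr fun n => ?_
  rw [coeff_rescale_exp, ← h]
  rfl

theorem A_eq (t : ℂ) (g : L) : A t g = incl L ∘ₗ logForm t g := by
  have h : A t g = (toConv (phi (-t)) *
      toConv (phi t ∘ₗ LinearMap.mulRight ℂ (incl L g))).ofConv := rfl
  rw [h, phi_eq, phi_eq, expLog_comp_mulRight, toConv_ofConv, ← mul_assoc, expLog_neg_mul, one_mul]

theorem toLie_incl (g : L) : toLie L (incl L g) = g :=
  LinearMap.leftInverse_apply_of_inj (LinearMap.ker_eq_bot.mpr incl_injective) g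

theorem toLie_comp_pr : toLie L ∘ₗ pr L = logProj L := by
  ext x
  rw [pr_eq]
  exact toLie_incl _

theorem toLie_comp_A (t : ℂ) (g : L) : toLie L ∘ₗ A t g = logForm t g := by
  ext x
  rw [A_eq]
  exact toLie_incl _

end EnvelopingLift

/-! ### The homotopy formula -/

namespace CoalgConv

variable {C L : Type*} [AddCommGroup C] [Module ℂ C] [Coalgebra ℂ C] [LieRing L] [LieAlgebra ℂ L]

/-- A trilinear form on `L` extended to maps from a coalgebra to `L`:
`x ↦ ∑ f(u(x⁽¹⁾), v(x⁽²⁾), w(x⁽³⁾))`. -/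
def convForm (f : L →ₗ[ℂ] L →ₗ[ℂ] L →ₗ[ℂ] ℂ) :
    (C →ₗ[ℂ] L) →ₗ[ℂ] (C →ₗ[ℂ] L) →ₗ[ℂ] (C →ₗ[ℂ] L) →ₗ[ℂ] (C →ₗ[ℂ] ℂ) :=
  LinearMap.llcomp ℂ _ _ _ app ∘ₗ app ∘ₗ LinearMap.llcomp ℂ C L (L →ₗ[ℂ] L →ₗ[ℂ] ℂ) f

variable {f : L →ₗ[ℂ] L →ₗ[ℂ] L →ₗ[ℂ] ℂ}

theorem convForm_apply (u v w : C →ₗ[ℂ] L) : convForm f u v w = app (app (f ∘ₗ u) v) w := rfl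

theorem IsCoderivation.convForm_comp {D : C →ₗ[ℂ] C} (hD : IsCoderivation D)
    (u v w : C →ₗ[ℂ] L) :
    convForm f u v w ∘ₗ D =
      convForm f (u ∘ₗ D) v w + convForm f u (v ∘ₗ D) w + convForm f u v (w ∘ₗ D) := by
  simp only [convForm_apply, hD.app_comp, map_add, LinearMap.add_apply]
  rfl

theorem HasConvDeriv.convForm {u u' v v' w w' : ℂ → C →ₗ[ℂ] L} (hu : HasConvDeriv u u')
    (hv : HasConvDeriv v v') (hw : HasConvDeriv w w') :
    HasConvDeriv (fun t => convForm f (u t) (v t) (w t)) fun t =>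
      convForm f (u' t) (v t) (w t) + convForm f (u t) (v' t) (w t) +
        convForm f (u t) (v t) (w' t) := by
  refine (((hu.comp_left f).conv_app hv).conv_app hw).congr fun t => ?_
  simp only [convForm_apply, map_add, LinearMap.add_apply]

theorem convForm_const (a b c : L) :
    convForm f (const a : C →ₗ[ℂ] L) (const b) (const c) = const (f a b c) := by
  simp only [convForm_apply, comp_const, app_const_left]

variable [IsCocomm ℂ C]

theorem convForm_swap_left (hf : ∀ a b c, f a b c = -f b a c) (u v w : C →ₗ[ℂ] L) :
    convForm f u v w = -convForm f v u w := by
  have h : f + f.flip = 0 := by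
    ext a b c
    exact eq_neg_iff_add_eq_zero.mp (hf a b c)
  rw [eq_neg_iff_add_eq_zero, convForm_apply, convForm_apply, app_comp_flip f v,
    ← LinearMap.add_apply,
    ← map_add, ← LinearMap.add_apply, ← map_add, ← LinearMap.add_comp, h]
  simp

theorem convForm_swap_right (hf : ∀ a b c, f a b c = -f a c b) (u v w : C →ₗ[ℂ] L) :
    convForm f u v w = -convForm f u w v := by
  have h : f ∘ₗ u + (LinearMap.lflip : (L →ₗ[ℂ] L →ₗ[ℂ] ℂ) ≃ₗ[ℂ] _).toLinearMap ∘ₗ f ∘ₗ u =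
      0 := by
    ext x b c
    exact eq_neg_iff_add_eq_zero.mp (hf (u x) b c)
  rw [eq_neg_iff_add_eq_zero, convForm_apply, convForm_apply, app_swap _ w, ← LinearMap.add_apply,
    ← map_add, ← LinearMap.add_apply, ← map_add, h]
  simp

/-- The cocycle identity of a trilinear form extends to maps from a coalgebra: both sides are
convolutions of the four maps, in one fixed order, with a quadrilinear form on `L`. -/
theorem convForm_cocycle
    (hf : ∀ a b c d : L, f ⁅a, b⁆ c d - f ⁅a, c⁆ b d + f ⁅a, d⁆ b c + f ⁅b, c⁆ a d - f ⁅b, d⁆ a c +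
      f ⁅c, d⁆ a b = 0) (a b c d : C →ₗ[ℂ] L) :
    convForm f (br a b) c d - convForm f (br a c) b d + convForm f (br a d) b c +
      convForm f (br b c) a d - convForm f (br b d) a c + convForm f (br c d) a b = 0 := by
  -- `s₂` and `s₃` permute the arguments of a quadrilinear form as in `q₂` and `q₃`.
  let quad : (L →ₗ[ℂ] L →ₗ[ℂ] L →ₗ[ℂ] L →ₗ[ℂ] ℂ) → (a b c d : C →ₗ[ℂ] L) → (C →ₗ[ℂ] ℂ) :=
    fun G a b c d => app (app (app (G ∘ₗ a) b) c) d
  let N : L →ₗ[ℂ] L →ₗ[ℂ] L →ₗ[ℂ] L →ₗ[ℂ] ℂ :=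
    LinearMap.llcomp ℂ L L (L →ₗ[ℂ] L →ₗ[ℂ] ℂ) f ∘ₗ (LieModule.toEnd ℂ L L : L →ₗ[ℂ] L →ₗ[ℂ] L)
  let s₂ : (L →ₗ[ℂ] L →ₗ[ℂ] L →ₗ[ℂ] L →ₗ[ℂ] ℂ) → (L →ₗ[ℂ] L →ₗ[ℂ] L →ₗ[ℂ] L →ₗ[ℂ] ℂ) :=
    fun G => (LinearMap.lflip : (L →ₗ[ℂ] L →ₗ[ℂ] L →ₗ[ℂ] ℂ) ≃ₗ[ℂ] _).toLinearMap ∘ₗ G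
  let s₃ : (L →ₗ[ℂ] L →ₗ[ℂ] L →ₗ[ℂ] L →ₗ[ℂ] ℂ) → (L →ₗ[ℂ] L →ₗ[ℂ] L →ₗ[ℂ] L →ₗ[ℂ] ℂ) :=
    fun G => LinearMap.llcomp ℂ L (L →ₗ[ℂ] L →ₗ[ℂ] ℂ) (L →ₗ[ℂ] L →ₗ[ℂ] ℂ)
      (LinearMap.lflip : (L →ₗ[ℂ] L →ₗ[ℂ] ℂ) ≃ₗ[ℂ] _).toLinearMap ∘ₗ G
  have q₁ : ∀ G a b c d, quad G a b c d = quad G.flip b a c d := by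
    intro G a b c d
    simp only [quad]
    rw [app_comp_flip]
  have q₂ : ∀ G a b c d, quad G a b c d = quad (s₂ G) a c b d := by
    intro G a b c d
    simp only [quad]
    rw [app_swap (G ∘ₗ a) b c]
    rfl
  have q₃ : ∀ G a b c d, quad G a b c d = quad (s₃ G) a b d c := by
    intro G a b c d
    simp only [quad]
    rw [app_swap (app (G ∘ₗ a) b) c d, comp_app]
    rfl
  have hN : ∀ a b c d, convForm f (br a b) c d = quad N a b c d := by
    intro a b c d
    rw [convForm_apply, br_def, comp_app]
    rfl
  have hadd : ∀ G H, quad G a b c d + quad H a b c d = quad (G + H) a b c d := by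
    intro G H
    simp only [quad, LinearMap.add_comp, map_add, LinearMap.add_apply]
  have h0 : N + s₃ (s₂ N) + (s₂ N).flip + s₂ (s₃ (s₂ N).flip) = s₂ N + s₃ (s₂ N).flip := by
    ext x y z w
    rw [← sub_eq_zero]
    refine Eq.trans ?_ (hf x y z w)
    simp only [LinearMap.add_apply]
    change N x y z w + N x w y z + N y z x w + N z w x y - (N x z y w + N y w x z) =
      N x y z w - N x z y w + N x w y z + N y z x w - N y w x z + N z w x y
    ring
  have h1 : quad N a b c d + quad N a d b c + quad N b c a d + quad N c d a b =
      quad N a c b d + quad N b d a c := by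
    rw [q₂ N a c b d, q₂ N a d b c, q₃ _ a b d c, q₂ N b c a d, q₁ _ b a c d, q₂ N b d a c,
      q₁ _ b a d c, q₃ _ a b d c, q₂ N c d a b, q₁ _ c a d b, q₃ _ a c d b, q₂ _ a c b d,
      hadd, hadd, hadd, hadd, h0]
  simp only [hN]
  rw [← sub_eq_zero] at h1
  rw [← h1]
  abel

end CoalgConv

namespace EnvelopingLift

open CoalgConv WithConv LieCE

variable {L : Type*} [LieRing L] [LieAlgebra ℂ L]

/-- An alternating form as a curried trilinear form. -/
def curryForm (f : L [⋀^Fin 3]→ₗ[ℂ] ℂ) : L →ₗ[ℂ] L →ₗ[ℂ] L →ₗ[ℂ] ℂ :=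
  TensorProduct.lcurry (.id ℂ) L L ℂ ∘ₗ TensorProduct.curry (triLin f)

theorem curryForm_apply (f : L [⋀^Fin 3]→ₗ[ℂ] ℂ) (a b c : L) : curryForm f a b c = f ![a, b, c] :=
  rfl

theorem curryForm_swap_left (f : L [⋀^Fin 3]→ₗ[ℂ] ℂ) (a b c : L) :
    curryForm f a b c = -curryForm f b a c := by
  rw [curryForm_apply, curryForm_apply, ← f.map_swap ![b, a, c] (i := 0) (j := 1) (by decide)]
  congr 1
  funext k
  fin_cases k <;> rfl

theorem curryForm_swap_right (f : L [⋀^Fin 3]→ₗ[ℂ] ℂ) (a b c : L) :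
    curryForm f a b c = -curryForm f a c b := by
  rw [curryForm_apply, curryForm_apply, ← f.map_swap ![a, c, b] (i := 1) (j := 2) (by decide)]
  congr 1
  funext k
  fin_cases k <;> rfl

theorem integrand_eq (f : L [⋀^Fin 3]→ₗ[ℂ] ℂ) (t : ℂ) (g h : L) :
    integrand f t g h = convForm (curryForm f) (logProj L) (logForm t g) (logForm t h) := by
  ext x
  rw [integrand, toLie_comp_pr, toLie_comp_A, toLie_comp_A, convForm_apply, app_app_eq_tri]
  simp only [LinearMap.comp_apply]
  generalize LinearMap.lTensor (U L) comul (comul (R := ℂ) x) = z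
  induction z using TensorProduct.induction_on with
  | zero => simp
  | add a b ha hb => simp only [map_add, ha, hb]
  | tmul a z =>
    induction z using TensorProduct.induction_on with
    | zero => simp
    | add a b ha hb => simp only [map_add, tmul_add, ha, hb]
    | tmul c d => rw [tri_tmul]; rfl

theorem cocycle_curryForm (f : Cochain L (Triv L) 3) (hf : d 3 f = 0) (a b c d : L) :
    curryForm (toForm f) ⁅a, b⁆ c d - curryForm (toForm f) ⁅a, c⁆ b d +
      curryForm (toForm f) ⁅a, d⁆ b c + curryForm (toForm f) ⁅b, c⁆ a d -
      curryForm (toForm f) ⁅b, d⁆ a c + curryForm (toForm f) ⁅c, d⁆ a b = 0 := by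
  have h : LieCE.d 3 f ![a, b, c, d] = 0 := by rw [hf]; rfl
  have h' := congrArg Triv.val h
  rw [d_apply, dFun] at h'
  simp only [trivial_lie_zero, smul_zero, Finset.sum_const_zero, zero_add] at h'
  simp only [Finset.sum_filter] at h'
  have e₁ : ∀ y, Fin.removeNth 1 (Function.update ![a, b, c, d] 0 y) = ![y, c, d] := by
    intro y; funext k; fin_cases k <;> rfl
  have e₂ : ∀ y, Fin.removeNth 2 (Function.update ![a, b, c, d] 0 y) = ![y, b, d] := by
    intro y; funext k; fin_cases k <;> rfl
  have e₃ : ∀ y, Fin.removeNth 2 (Function.update ![a, b, c, d] 1 y) = ![a, y, d] := by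
    intro y; funext k; fin_cases k <;> rfl
  have e₄ : ∀ y, Fin.removeNth 3 (Function.update ![a, b, c, d] 0 y) = ![y, b, c] := by
    intro y; funext k; fin_cases k <;> rfl
  have e₅ : ∀ y, Fin.removeNth 3 (Function.update ![a, b, c, d] 1 y) = ![a, y, c] := by
    intro y; funext k; fin_cases k <;> rfl
  have e₆ : ∀ y, Fin.removeNth 3 (Function.update ![a, b, c, d] 2 y) = ![a, b, y] := by
    intro y; funext k; fin_cases k <;> rfl
  simp [Fin.sum_univ_succ, e₁, e₂, e₃, e₄, e₅, e₆] at h'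
  have e : ∀ x y z, TrivialLieModule.equiv ℂ L ℂ (f ![x, y, z]) = curryForm (toForm f) x y z :=
    fun _ _ _ => rfl
  simp only [e] at h'
  have s₁ := curryForm_swap_left (toForm f) a ⁅b, c⁆ d
  have s₂ := curryForm_swap_left (toForm f) a ⁅b, d⁆ c
  have s₃ := curryForm_swap_right (toForm f) a b ⁅c, d⁆
  have s₄ := curryForm_swap_left (toForm f) a ⁅c, d⁆ b
  linear_combination -h' + s₁ - s₂ - s₃ + s₄

/-- Cartan's homotopy formula: the derivative in `t` of the pullback of the invariant form `f` along
the contraction is the differential of its contraction with the velocity. -/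
theorem hasConvDeriv_convForm (f : Cochain L (Triv L) 3) (hf : d 3 f = 0) (g₀ g₁ g₂ : L) :
    HasConvDeriv (fun t => convForm (curryForm (toForm f)) (logForm t g₀) (logForm t g₁)
        (logForm t g₂)) fun t =>
      integrand (toForm f) t g₁ g₂ ∘ₗ LinearMap.mulRight ℂ (incl L g₀) -
      integrand (toForm f) t g₀ g₂ ∘ₗ LinearMap.mulRight ℂ (incl L g₁) +
      integrand (toForm f) t g₀ g₁ ∘ₗ LinearMap.mulRight ℂ (incl L g₂) -
      integrand (toForm f) t ⁅g₀, g₁⁆ g₂ + integrand (toForm f) t ⁅g₀, g₂⁆ g₁ +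
      integrand (toForm f) t g₀ ⁅g₁, g₂⁆ := by
  have H := isContraction_log (L := L)
  refine (HasConvDeriv.convForm (H.hasConvDeriv g₀) (H.hasConvDeriv g₁)
    (H.hasConvDeriv g₂)).congr fun t => ?_
  set F := curryForm (toForm f) with hF
  have hl := convForm_swap_left (C := U L) (curryForm_swap_left (toForm f))
  have hr := convForm_swap_right (C := U L) (curryForm_swap_right (toForm f))
  have hc := convForm_cocycle (C := U L) (cocycle_curryForm f hf) (logProj L) (logForm t g₀)
    (logForm t g₁) (logForm t g₂)
  have hA : ∀ g h : L, logForm t ⁅g, h⁆ = logForm t h ∘ₗ LinearMap.mulRight ℂ (incl L g) -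
      logForm t g ∘ₗ LinearMap.mulRight ℂ (incl L h) + br (logForm t g) (logForm t h) := by
    intro g h
    have := H.curvature_eq_zero g h t
    rw [curvature] at this
    rw [← sub_eq_zero, ← neg_eq_zero, ← this]
    abel
  rw [← hF] at hl hr hc
  simp only [integrand_eq, ← hF, (H.isCoderivation _).convForm_comp, hA, map_add, map_sub,
    LinearMap.add_apply, LinearMap.sub_apply]
  generalize logProj L = q at *
  generalize logForm t g₀ = A₀ at *
  generalize logForm t g₁ = A₁ at *
  generalize logForm t g₂ = A₂ at *
  -- Both sides are brought to terms with `q ∘ₗ _`, `q` or a bracket in front; what remains is `hc`.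
  rw [hl A₀ (q ∘ₗ _) A₂, hl A₀ (br A₁ q) A₂, hr A₀ A₁ (q ∘ₗ _), hl A₀ (q ∘ₗ _) A₁,
    hr A₀ A₁ (br A₂ q), hl A₀ (br A₂ q) A₁, br_skew A₀ q, br_skew A₁ q, br_skew A₂ q,
    hl q (br A₀ A₁) A₂, hl q (br A₀ A₂) A₁, hr q A₀ (br A₁ A₂), hl q (br A₁ A₂) A₀,
    hr q (A₂ ∘ₗ _) A₁, hr q (A₀ ∘ₗ LinearMap.mulRight ℂ (incl L g₂)) A₁]
  simp only [map_neg, LinearMap.neg_apply]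
  rw [← sub_eq_zero, ← neg_eq_zero, ← hc]
  abel

theorem d_alphaTilde (f : Cochain L (Triv L) 3) (hf : d 3 f = 0) (v : Fin 3 → L) (x : U L) :
    d 2 (alphaTilde f) v x = augmentation L x * Triv.val (f v) := by
  have i := integrand_integrable (toForm f)
  have h1 : d 2 (alphaTilde f) v x =
      ∫ t in (0 : ℝ)..1, (integrand (toForm f) t (v 1) (v 2) ∘ₗ LinearMap.mulRight ℂ (incl L (v 0)) -
      integrand (toForm f) t (v 0) (v 2) ∘ₗ LinearMap.mulRight ℂ (incl L (v 1)) +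
      integrand (toForm f) t (v 0) (v 1) ∘ₗ LinearMap.mulRight ℂ (incl L (v 2)) -
      integrand (toForm f) t ⁅v 0, v 1⁆ (v 2) + integrand (toForm f) t ⁅v 0, v 2⁆ (v 1) +
      integrand (toForm f) t (v 0) ⁅v 1, v 2⁆) x := by
    rw [d_apply, dFun]
    simp only [Finset.sum_filter]
    simp [Fin.sum_univ_succ]
    rw [intervalIntegral.integral_add (((((i _ _ _).sub (i _ _ _)).add (i _ _ _)).sub
        (i _ _ _)).add (i _ _ _)) (i _ _ _),
      intervalIntegral.integral_add ((((i _ _ _).sub (i _ _ _)).add (i _ _ _)).sub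
        (i _ _ _)) (i _ _ _),
      intervalIntegral.integral_sub (((i _ _ _).sub (i _ _ _)).add (i _ _ _)) (i _ _ _),
      intervalIntegral.integral_add ((i _ _ _).sub (i _ _ _)) (i _ _ _),
      intervalIntegral.integral_sub (i _ _ _) (i _ _ _)]
    have k₀ : ∀ (g : L) (w : Fin 2 → L), UDual.equiv L ⁅g, alphaTilde f w⁆ x =
      ∫ t in (0 : ℝ)..1, integrand (toForm f) t (w 0) (w 1) (x * incl L g) := fun _ _ => rfl
    have k₁ : ∀ (w : Fin 2 → L), UDual.equiv L (alphaTilde f w) x =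
      ∫ t in (0 : ℝ)..1, integrand (toForm f) t (w 0) (w 1) x := fun _ => rfl
    simp only [k₀, k₁]
    change ((∫ t in (0 : ℝ)..1, integrand (toForm f) t (v 1) (v 2) (x * incl L (v 0))) +
      (-(∫ t in (0 : ℝ)..1, integrand (toForm f) t (v 0) (v 2) (x * incl L (v 1))) +
        ∫ t in (0 : ℝ)..1, integrand (toForm f) t (v 0) (v 1) (x * incl L (v 2)))) +
      (-(∫ t in (0 : ℝ)..1, integrand (toForm f) t ⁅v 0, v 1⁆ (v 2) x) +
        ((∫ t in (0 : ℝ)..1, integrand (toForm f) t ⁅v 0, v 2⁆ (v 1) x) +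
        ∫ t in (0 : ℝ)..1, integrand (toForm f) t (v 0) ⁅v 1, v 2⁆ x)) = _
    ring
  have h2 := (hasConvDeriv_convForm f hf (v 0) (v 1) (v 2) x).integral
  have h3 : toForm f ![v 0, v 1, v 2] = Triv.val (f v) := by
    have : ![v 0, v 1, v 2] = v := by funext k; fin_cases k <;> rfl
    rw [this]
    rfl
  rw [h1, h2]
  simp only [isContraction_log.A_one, isContraction_log.A_zero, convForm_const, map_zero,
    LinearMap.zero_apply, sub_zero, const_apply, curryForm_apply, h3, counit_eq, smul_eq_mul]

end EnvelopingLift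

end

theorem mainTheorem2 {𝔤 : Type*} [LieRing 𝔤] [LieAlgebra ℂ 𝔤]
    (f : LieCE.Cochain 𝔤 (EnvelopingLift.Triv 𝔤) 3) (hf : LieCE.d 3 f = 0) :
    -- the formula for `α̃` makes sense: `𝔤` embeds in `U 𝔤`, and `pr`, `A_t` take values in `𝔤`
    (Function.Injective (EnvelopingLift.incl 𝔤) ∧
      (∀ x : EnvelopingLift.U 𝔤,
        EnvelopingLift.pr 𝔤 x ∈ LinearMap.range (EnvelopingLift.incl 𝔤)) ∧
      (∀ (t : ℂ) (g : 𝔤) (x : EnvelopingLift.U 𝔤),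
        EnvelopingLift.A t g x ∈ LinearMap.range (EnvelopingLift.incl 𝔤))) ∧
    -- the coboundary of `α̃` is `ε(x) f`
    (∀ (v : Fin 3 → 𝔤) (x : EnvelopingLift.U 𝔤),
      LieCE.d 2 (EnvelopingLift.alphaTilde f) v x =
        EnvelopingLift.augmentation 𝔤 x * EnvelopingLift.Triv.val (f v)) ∧
    -- its restriction to `ℂ ⊗ Λ³ 𝔤` is `f`
    (∀ (v : Fin 3 → 𝔤) (c : ℂ),
      LieCE.d 2 (EnvelopingLift.alphaTilde f) v (algebraMap ℂ (EnvelopingLift.U 𝔤) c) =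
        c * EnvelopingLift.Triv.val (f v)) ∧
    -- `α` is a cocycle, and `∂[α] = [f]`
    ∃ hα : LieCE.d 2 (EnvelopingLift.alpha f) = 0,
      LieCE.connecting (EnvelopingLift.dualAug 𝔤) (EnvelopingLift.dualRes 𝔤)
        EnvelopingLift.dualAug_injective EnvelopingLift.dual_exact
        EnvelopingLift.dualRes_surjective 2 (LieCE.cls (EnvelopingLift.alpha f) hα) =
      LieCE.cls f hf := by
  have hd := EnvelopingLift.d_alphaTilde f hf
  have hpush : LieCE.d 2 (EnvelopingLift.alphaTilde f) =
      LieCE.push (EnvelopingLift.dualAug 𝔤) f := by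
    refine AlternatingMap.ext fun v => EnvelopingLift.UDual.ext fun x => ?_
    rw [hd, LieCE.push_apply, EnvelopingLift.dualAug_apply, mul_comm]
  have hα : LieCE.d 2 (EnvelopingLift.alpha f) = 0 := by
    rw [EnvelopingLift.alpha, LieCE.d_push]
    refine AlternatingMap.ext fun v => EnvelopingLift.UPlusDual.ext fun x => ?_
    rw [LieCE.push_apply, EnvelopingLift.dualRes_apply, hd,
      show EnvelopingLift.augmentation 𝔤 (x : EnvelopingLift.U 𝔤) = 0 from x.2, zero_mul]
    rfl
  refine ⟨⟨EnvelopingLift.incl_injective, fun x => ?_, fun t g x => ?_⟩, hd, fun v c => ?_, hα,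
    LieCE.connecting_cls _ _ _ _ _ _ _ hpush _ _⟩
  · rw [EnvelopingLift.pr_eq]
    exact ⟨_, rfl⟩
  · rw [EnvelopingLift.A_eq]
    exact ⟨_, rfl⟩
  · rw [hd, AlgHom.commutes]
    rfl
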